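/- Let $\mathcal A$ be a finite set of $N\ge 2$ arms. Arm $a$ has mean reward $r_a\in[0,1]$. Suppose that there is a unique optimal arm $a^\star$, i.e. $r_{a^\star}>r_a$ for all $a\ne a^\star$, and put $r^\star=r_{a^\star}=\max_a r_a$ and $\Delta=r^\star-\max_{a\neq a^\star}r_a>0$. Let $\beta\in(0,1]$ and $$\alpha(p)=\frac{\beta}{\log(e-\log p)} .$$ The SAMBA process with learning rate $\alpha$, started from a probability vector $p(0)=(p_a(0))_{a\in\mathcal A}$ with all entries positive, is the following. At each time $t=0,1,2,\dots$, conditionally on the past, an arm is played, equal to $a$ with probability $p_a(t)$; a leading arm $a_\star(t)$ is chosen uniformly at random among the arms maximizing $p_a(t)$; the rewards $R_a(t)\in\{0,1\}$ are Bernoulli with means $r_a$; and all of these are independent. Write $I_a(t)$ for the indicator that $a$ is played at time $t$. For $a\neq l:=a_\star(t)$ set $$p_a(t+1)=p_a(t)+\alpha(p_a(t))\,p_a(t)^2\left[\frac{I_a(t)R_a(t)}{p_a(t)}-\frac{I_{l}(t)R_{l}(t)}{p_{l}(t)}\right],$$ and set $p_{l}(t+1)=1-\sum_{a\ne l}p_a(t+1)$.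 The regret is $$\mathcal R(T)=r^\star T-\mathbb E\Big[\sum_{t=0}^{T-1}\sum_{a\in\mathcal A}I_a(t)R_a(t)\Big].$$ Then $(p(t))_{t\geq 0}$ is a (time-homogeneous) Markov chain; with probability $1$, $p_{a^\star}(t)\to1$ as $t\to\infty$; the quantity $$Q:=\sum_{t=0}^\infty\mathbb P\big(p_{a^\star}(t)\le \tfrac12\big)$$ is finite; and for every integer $T\ge1$ $$\mathcal R(T)\le\frac{N}{\beta\Delta}\,\log T\cdot\log(e+\log T)+Q+1 .$$ -/

import Mathlib

open MeasureTheory ProbabilityTheory Filter Topology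

namespace SAMBA

noncomputable section

variable {Arm Ω : Type*} [Fintype Arm] [DecidableEq Arm]

/-- The real value of a Bernoulli reward. -/
def rewardVal (b : Bool) : ℝ := if b then 1 else 0

/-- The indicator `I_a` that the arm `a` is the arm `played`. -/
def playInd (played a : Arm) : ℝ := if played = a then 1 else 0

/-- The maximal mean reward `r^⋆ = max_a r_a`. -/
def bestMean (r : Arm → ℝ) : ℝ := ⨆ a, r a

/-- The gap `r^⋆ - max_{a ≠ a^⋆} r_a`. -/
def gap (r : Arm → ℝ) (aStar : Arm) : ℝ :=
  bestMean r - ⨆ a : {a : Arm // a ≠ aStar}, r a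

/-- The arms of maximal probability. -/
def leaders (p : Arm → ℝ) : Finset Arm := {l | ∀ b, p b ≤ p l}

/-- The update of the probability of an arm `a` that is not the leading arm:
`p_a + α(p_a) p_a² (I_a R_a / p_a - I_l R_l / p_l)`,
where `l` is the leading arm and `R` the vector of rewards. -/
def armUpdate (α : ℝ → ℝ) (p : Arm → ℝ) (played l : Arm) (R : Arm → Bool) (a : Arm) : ℝ :=
  p a + α (p a) * p a ^ 2 *
    (playInd played a * rewardVal (R a) / p a - playInd played l * rewardVal (R l) / p l)

/-- One step of the algorithm: the arms other than the leading arm `l` are updated by `armUpdate`,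
and the leading arm receives the remaining mass. -/
def step (α : ℝ → ℝ) (p : Arm → ℝ) (played l : Arm) (R : Arm → Bool) : Arm → ℝ := fun a =>
  if a = l then 1 - ∑ b ∈ Finset.univ.erase l, armUpdate α p played l R b
  else armUpdate α p played l R a

/-- The probability vectors `p(t)` maintained by the algorithm started from `p₀`, where
`A t`, `L t` and `R t` are the arm played, the leading arm and the rewards at time `t`. -/
def prob (α : ℝ → ℝ) (p₀ : Arm → ℝ) (A L : ℕ → Ω → Arm) (R : ℕ → Ω → Arm → Bool) :
    ℕ → Ω → Arm → ℝ
  | 0, _ => p₀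
  | t + 1, ω => step α (prob α p₀ A L R t ω) (A t ω) (L t ω) (R t ω)

/-- The σ-algebra of everything that happened strictly before time `t`. -/
abbrev history [MeasurableSpace Arm] (A L : ℕ → Ω → Arm) (R : ℕ → Ω → Arm → Bool) (t : ℕ) :
    MeasurableSpace Ω :=
  ⨆ (s : ℕ) (_ : s < t),
    MeasurableSpace.comap (fun ω => (A s ω, L s ω, R s ω)) inferInstance

/-- `A`, `L`, `R` (arm played, leading arm, rewards) are a run of SAMBA with learning rate `α`
from the initial vector `p₀`, for arms with mean rewards `r`: given the past, the arm played at
time `t` has law `p(t)`, the leading arm is uniform on the set of arms of maximal probability, the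
reward of each arm `b` is Bernoulli with mean `r b`, and all of these are independent.
In particular the rewards `R t ω b`, for all `t` and `b`, are independent. -/
structure IsRun [MeasurableSpace Arm] [MeasurableSpace Ω] (P : Measure Ω)
    (r : Arm → ℝ) (α : ℝ → ℝ) (p₀ : Arm → ℝ)
    (A L : ℕ → Ω → Arm) (R : ℕ → Ω → Arm → Bool) : Prop where
  measurable_A : ∀ t, Measurable (A t)
  measurable_L : ∀ t, Measurable (L t)
  measurable_R : ∀ t, Measurable (R t)
  law : ∀ (t : ℕ) (a l : Arm) (ρ : Arm → Bool),
    P[Set.indicator {ω | A t ω = a ∧ L t ω = l ∧ R t ω = ρ} (fun _ => (1 : ℝ)) | history A L R t]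
      =ᵐ[P] fun ω =>
        prob α p₀ A L R t ω a *
        (if l ∈ leaders (prob α p₀ A L R t ω)
          then 1 / ((leaders (prob α p₀ A L R t ω)).card : ℝ) else 0) *
        ∏ b, (if ρ b then r b else 1 - r b)

/-- The regret `r^⋆ T - E[∑_{t < T} ∑_a I_a(t) R_a(t)]`. -/
def regret [MeasurableSpace Ω] (P : Measure Ω) (r : Arm → ℝ)
    (A : ℕ → Ω → Arm) (R : ℕ → Ω → Arm → Bool) (T : ℕ) : ℝ :=
  bestMean r * T -
    ∫ ω, ∑ t ∈ Finset.range T, ∑ a, playInd (A t ω) a * rewardVal (R t ω a) ∂P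

/-- `X` is a time-homogeneous Markov chain (with respect to its natural filtration). -/
def IsMarkovChain {S : Type*} [MeasurableSpace S] [MeasurableSpace Ω] (P : Measure Ω)
    (X : ℕ → Ω → S) : Prop :=
  (∀ t, Measurable (X t)) ∧
  ∃ κ : Kernel S S, IsMarkovKernel κ ∧
    ∀ (t : ℕ) (B : Set S), MeasurableSet B →
      P[Set.indicator (X (t + 1) ⁻¹' B) (fun _ => (1 : ℝ)) |
          ⨆ (s : ℕ) (_ : s ≤ t), MeasurableSpace.comap (X s) inferInstance]
        =ᵐ[P] fun ω => (κ (X t ω)).real B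

/-- The learning rate `α(p) = β / log (e - log p)`. -/
def logLogRate (β : ℝ) (p : ℝ) : ℝ := β / Real.log (Real.exp 1 - Real.log p)

end

end SAMBA

/-! Everything rests on one-step drifts. If `l` leads, an arm `b ≠ l` has mean increment `α(p_b)
p_b² (r_b - r_l)`, and the leader receives the opposite of the sum of these. A random choice among
tied leaders only averages drifts, so each estimate is made for a fixed leader.

Return to the optimum. Write `x` for the probability of the optimal arm and take `V = K (1 - x) + 1
/ x²`. Near `x = 0` the rate is small compared with the gap, so the second-order terms of `1 / x²`
lose to its first-order decrease, of order `α(x) / x`, which is bounded below since `α(x) ≥ β x /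
2`. Away from `0` the term `K (1 - x)` dominates for large `K`. Hence `V` drifts by at most `-c (1 -
x)³` (`exists_lyapunov`). As `V ≥ 0`, the expectations of `(1 - x)³` are summable over time, which
gives both the finiteness of `Q` and the almost sure convergence.

Regret. When the optimal arm leads, `p_a` decreases in mean by `α(p_a) p_a² (r⋆ - r_a)`. A convex
potential of slope `-1 / (α(p) p)` therefore grows in mean by at least `p_a (r⋆ - r_a)`, the regret
due to `a`. That potential is infinite at `0`, so its slope is frozen below a level `δ`, at a cost
of at most `δ / 3` per arm and step. When the optimal arm does not lead, `x ≤ 1/2` and the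
comparison fails by at most `1`, which is charged to `Q` (`regret_le_potential_drift`). The total
growth is at most `N - 1` times the potential at `0`; for `δ = e / T` this value is at most `∫₀^{log
T} log (e + x) dx / β`. What remains is a numerical comparison, where the factor `1 / Δ` enters only
through `Δ ≤ 1`. -/

namespace SAMBA

/-! ### The learning rate -/

lemma one_lt_log_exp_sub_log {p : ℝ} (h0 : 0 < p) (h1 : p < 1) :
    1 < Real.log (Real.exp 1 - Real.log p) := by
  have h := Real.log_neg h0 h1
  rw [Real.lt_log_iff_exp_lt (by linarith [Real.exp_pos 1])]
  linarith

lemma one_le_log_exp_sub_log {p : ℝ} (h0 : 0 < p) (h1 : p ≤ 1) :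
    1 ≤ Real.log (Real.exp 1 - Real.log p) := by
  have h := Real.log_nonpos h0.le h1
  rw [Real.le_log_iff_exp_le (by linarith [Real.exp_pos 1])]
  linarith

lemma logLogRate_pos {β p : ℝ} (hβ : 0 < β) (h0 : 0 < p) (h1 : p ≤ 1) : 0 < logLogRate β p :=
  div_pos hβ (by linarith [one_le_log_exp_sub_log h0 h1])

lemma logLogRate_lt_one {β p : ℝ} (hβ : β ≤ 1) (h0 : 0 < p) (h1 : p < 1) :
    logLogRate β p < 1 := by
  have h := one_lt_log_exp_sub_log h0 h1
  rw [logLogRate, div_lt_one (by linarith)]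
  linarith

lemma logLogRate_mono {β p q : ℝ} (hβ : 0 < β) (h0 : 0 < p) (hpq : p ≤ q) (h1 : q ≤ 1) :
    logLogRate β p ≤ logLogRate β q := by
  have hq := one_le_log_exp_sub_log (h0.trans_le hpq) h1
  have hl := Real.log_le_log h0 hpq
  have hq0 := Real.log_nonpos (h0.trans_le hpq).le h1
  exact div_le_div_of_nonneg_left hβ.le (by linarith)
    (Real.log_le_log (by linarith [Real.exp_pos 1]) (by linarith))

/-- Since `-log p ≤ 1 / p - 1`, the denominator of the rate is at most `2 / p`. This crude bound is
enough for the Lyapunov drift, where only some positive lower bound matters. -/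
lemma half_mul_le_logLogRate {β p : ℝ} (hβ : 0 < β) (h0 : 0 < p) (h1 : p ≤ 1) :
    β * p / 2 ≤ logLogRate β p := by
  have hq := one_le_log_exp_sub_log h0 h1
  have hl0 := Real.log_nonpos h0.le h1
  have h2 := Real.log_le_sub_one_of_pos
    (show 0 < Real.exp 1 - Real.log p by linarith [Real.exp_pos 1])
  have h3 := Real.one_sub_inv_le_log_of_pos h0
  have h4 : Real.log (Real.exp 1 - Real.log p) ≤ 2 / p := by
    have : 1 ≤ p⁻¹ := (one_le_inv₀ h0).2 h1
    have : 2 / p = 2 * p⁻¹ := by ring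
    linarith [Real.exp_one_lt_d9]
  rw [logLogRate, le_div_iff₀ (by linarith)]
  calc β * p / 2 * Real.log (Real.exp 1 - Real.log p) ≤ β * p / 2 * (2 / p) := by gcongr
    _ = β := by field_simp

/-- Supplies the level below which the rate is too small for second-order effects to matter in the
Lyapunov drift. -/
lemma exists_logLogRate_le (β : ℝ) {c : ℝ} (hc : 0 < c) :
    ∃ ε, 0 < ε ∧ ε ≤ 1 / 2 ∧ logLogRate β ε ≤ c := by
  have h : Tendsto (logLogRate β) (𝓝[>] 0) (𝓝 0) := by
    refine Tendsto.div_atTop tendsto_const_nhds (Real.tendsto_log_atTop.comp ?_)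
    have := (tendsto_neg_atBot_atTop.comp Real.tendsto_log_nhdsGT_zero)
    simpa [sub_eq_add_neg] using tendsto_atTop_add_const_left _ (Real.exp 1) this
  have h1 := h.eventually (gt_mem_nhds hc)
  have h2 : ∀ᶠ x : ℝ in 𝓝[>] 0, x ∈ Set.Ioo (0 : ℝ) (1 / 2) :=
    Ioo_mem_nhdsGT (by norm_num)
  obtain ⟨ε, h3, h4⟩ := (h1.and h2).exists
  exact ⟨ε, h4.1, h4.2.le, h3.le⟩

lemma measurable_logLogRate (β : ℝ) : Measurable (logLogRate β) := by
  unfold logLogRate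
  fun_prop

/-! ### The truncated potential -/

/-- Minus the slope of the truncated potential: `1 / (α(m) m)` with `m = max u δ`. -/
noncomputable def truncSlope (β δ u : ℝ) : ℝ := 1 / (logLogRate β (max u δ) * max u δ)

lemma truncSlope_pos {β δ u : ℝ} (hβ : 0 < β) (hδ : 0 < δ) (hδ1 : δ ≤ 1) (hu : u ≤ 1) :
    0 < truncSlope β δ u := by
  have h0 : 0 < max u δ := lt_max_of_lt_right hδ
  exact one_div_pos.2 (mul_pos (logLogRate_pos hβ h0 (max_le hu hδ1)) h0)

lemma truncSlope_antitoneOn {β δ : ℝ} (hβ : 0 < β) (hδ : 0 < δ) (hδ1 : δ ≤ 1) :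
    AntitoneOn (truncSlope β δ) (Set.Iic 1) := by
  intro u hu v hv huv
  have h0 : 0 < max u δ := lt_max_of_lt_right hδ
  have h1 := max_le_max_right δ huv
  have h2 : max v δ ≤ 1 := max_le hv hδ1
  have h3 := logLogRate_pos hβ h0 (h1.trans h2)
  exact one_div_le_one_div_of_le (mul_pos h3 h0)
    (mul_le_mul (logLogRate_mono hβ h0 h1 h2) h1 h0.le (h3.le.trans (logLogRate_mono hβ h0 h1 h2)))

lemma truncSlope_intervalIntegrable {β δ p q : ℝ} (hβ : 0 < β) (hδ : 0 < δ) (hδ1 : δ ≤ 1)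
    (hp : p ≤ 1) (hq : q ≤ 1) : IntervalIntegrable (truncSlope β δ) volume p q := by
  refine AntitoneOn.intervalIntegrable ((truncSlope_antitoneOn hβ hδ hδ1).mono ?_)
  intro x hx
  exact hx.2.trans (max_le hp hq)

/-- The truncated potential of an arm: convex and decreasing on `[0, 1]`, linear on `[0, δ]`. -/
noncomputable def truncPotential (β δ p : ℝ) : ℝ := ∫ u in p..1, truncSlope β δ u

/-- Convexity, read off from the monotone slope. Being a tangent inequality valid for every jump, it
leaves no second-order error when averaged over a step. -/
lemma truncPotential_tangent {β δ p q : ℝ} (hβ : 0 < β) (hδ : 0 < δ) (hδ1 : δ ≤ 1)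
    (hp : p ≤ 1) (hq : q ≤ 1) :
    truncSlope β δ p * (p - q) ≤ truncPotential β δ q - truncPotential β δ p := by
  have hA := truncSlope_antitoneOn hβ hδ hδ1
  have hI : ∀ {x y : ℝ}, x ≤ 1 → y ≤ 1 → IntervalIntegrable (truncSlope β δ) volume x y :=
    fun hx hy => truncSlope_intervalIntegrable hβ hδ hδ1 hx hy
  have e : truncPotential β δ q - truncPotential β δ p = ∫ u in q..p, truncSlope β δ u := by
    rw [truncPotential, truncPotential, sub_eq_iff_eq_add,
      intervalIntegral.integral_add_adjacent_intervals (hI hq hp) (hI hp le_rfl)]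
  rw [e]
  rcases le_total q p with h | h
  · have := intervalIntegral.integral_mono_on h intervalIntegrable_const (hI hq hp)
      (fun x hx => hA (hx.2.trans hp) hp hx.2 : ∀ x ∈ Set.Icc q p, truncSlope β δ p ≤ _)
    simpa [mul_comm] using this
  · have := intervalIntegral.integral_mono_on h (hI hp hq) intervalIntegrable_const
      (fun x hx => hA hp (hx.2.trans hq) hx.1 : ∀ x ∈ Set.Icc p q, _ ≤ truncSlope β δ p)
    rw [intervalIntegral.integral_symm]
    simp only [intervalIntegral.integral_const, smul_eq_mul] at this
    linarith

lemma truncPotential_nonneg {β δ p : ℝ} (hβ : 0 < β) (hδ : 0 < δ) (hδ1 : δ ≤ 1)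
    (hp : p ≤ 1) : 0 ≤ truncPotential β δ p :=
  intervalIntegral.integral_nonneg hp fun _ hu => (truncSlope_pos hβ hδ hδ1 hu.2).le

lemma truncPotential_le_zero {β δ p : ℝ} (hβ : 0 < β) (hδ : 0 < δ) (hδ1 : δ ≤ 1)
    (h0 : 0 ≤ p) (hp : p ≤ 1) : truncPotential β δ p ≤ truncPotential β δ 0 := by
  have h1 := truncPotential_tangent hβ hδ hδ1 hp zero_le_one
  have h2 := mul_nonneg (truncSlope_pos hβ hδ hδ1 hp).le h0
  linarith [sub_zero p ▸ h1]

/-- An antiderivative of `log (e + x)`, vanishing at `0`. -/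
noncomputable def logPrimitive (x : ℝ) : ℝ :=
  (Real.exp 1 + x) * Real.log (Real.exp 1 + x) - Real.exp 1 - x

lemma hasDerivAt_logPrimitive {x : ℝ} (hx : 0 ≤ x) :
    HasDerivAt logPrimitive (Real.log (Real.exp 1 + x)) x := by
  have h0 : Real.exp 1 + x ≠ 0 := by linarith [Real.exp_pos 1]
  have h1 : HasDerivAt (fun x => Real.exp 1 + x) 1 x := (hasDerivAt_id x).const_add _
  have h2 := ((h1.mul (h1.log h0)).sub_const (Real.exp 1)).sub (hasDerivAt_id x)
  refine HasDerivAt.congr_deriv (f := logPrimitive) h2 ?_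
  field_simp
  ring

/-- The frozen part `[0, δ]` contributes `1 / α(δ)`. On `[δ, 1]` the substitution `x = -log u` turns
`du / (α(u) u)` into `log (e + x) dx / β`. -/
lemma truncPotential_zero {β δ : ℝ} (hβ : 0 < β) (hδ : 0 < δ) (hδ1 : δ ≤ 1) :
    truncPotential β δ 0 =
      (Real.log (Real.exp 1 - Real.log δ) + logPrimitive (-Real.log δ)) / β := by
  have hI : ∀ {x y : ℝ}, x ≤ 1 → y ≤ 1 → IntervalIntegrable (truncSlope β δ) volume x y :=
    fun hx hy => truncSlope_intervalIntegrable hβ hδ hδ1 hx hy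
  have e1 : ∫ u in (0 : ℝ)..δ, truncSlope β δ u = Real.log (Real.exp 1 - Real.log δ) / β := by
    rw [intervalIntegral.integral_congr (g := fun _ => 1 / (logLogRate β δ * δ))]
    · have := one_le_log_exp_sub_log hδ hδ1
      rw [intervalIntegral.integral_const, logLogRate]
      simp only [smul_eq_mul]
      field_simp
      ring
    · intro x hx
      rw [Set.uIcc_of_le hδ.le] at hx
      simp [truncSlope, max_eq_right hx.2]
  have e2 : ∫ u in δ..1, truncSlope β δ u =
      -logPrimitive (-Real.log 1) / β - -logPrimitive (-Real.log δ) / β := by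
    refine intervalIntegral.integral_eq_sub_of_hasDerivAt
      (f := fun u => -logPrimitive (-Real.log u) / β) (fun u hu => ?_) (hI hδ1 le_rfl)
    rw [Set.uIcc_of_le hδ1] at hu
    have hu0 : 0 < u := hδ.trans_le hu.1
    have hl := Real.log_nonpos hu0.le hu.2
    have h1 := (hasDerivAt_logPrimitive (neg_nonneg.2 hl)).comp u (Real.hasDerivAt_log hu0.ne').neg
    have h2 := h1.neg.div_const β
    have := one_le_log_exp_sub_log hu0 hu.2
    refine HasDerivAt.congr_deriv h2 ?_
    rw [truncSlope, max_eq_left hu.1, logLogRate, ← sub_eq_add_neg]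
    field_simp
  have e3 : logPrimitive (-Real.log 1) = 0 := by simp [logPrimitive]
  rw [truncPotential, ← intervalIntegral.integral_add_adjacent_intervals
    (hI zero_le_one hδ1) (hI hδ1 le_rfl), e1, e2, e3]
  ring

/-- The integrand `log (e + ·)` is increasing, so its integral over `[x, x + 1]` is at least its
value at `x`. This absorbs the frozen part of the potential when `δ = e / T`. -/
lemma log_add_logPrimitive_le {x : ℝ} (hx : 0 ≤ x) :
    Real.log (Real.exp 1 + x) + logPrimitive x ≤ logPrimitive (x + 1) := by
  have h0 : 0 < Real.exp 1 + x := by linarith [Real.exp_pos 1]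
  unfold logPrimitive
  rw [← add_assoc]
  generalize Real.exp 1 = e at *
  set z := e + x
  have h1 := Real.log_le_sub_one_of_pos (show 0 < z / (z + 1) by positivity)
  rw [Real.log_div h0.ne' (by linarith)] at h1
  have h2 : (z + 1) * (Real.log z - Real.log (z + 1)) ≤ (z + 1) * (z / (z + 1) - 1) :=
    mul_le_mul_of_nonneg_left h1 (by linarith)
  have h3 : (z + 1) * (z / (z + 1) - 1) = -1 := by field_simp; ring
  nlinarith

/-- The part of the drift that the truncation of the potential loses is at most `δ / 3`. -/
lemma sub_le_truncSlope_mul {β δ p : ℝ} (hβ : 0 < β) (hδ : 0 < δ) (hδ1 : δ ≤ 1)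
    (h0 : 0 < p) (h1 : p ≤ 1) :
    p - δ / 3 ≤ truncSlope β δ p * (logLogRate β p * p ^ 2) := by
  have hp := logLogRate_pos hβ h0 h1
  rcases le_total δ p with h | h
  · have : truncSlope β δ p * (logLogRate β p * p ^ 2) = p := by
      rw [truncSlope, max_eq_left h]; field_simp
    linarith
  -- Below the truncation level, with `p = u δ`, the right-hand side is `δ u² (a / b)`, where `a`
  -- and `b` are the logarithms in the rates at `δ` and at `p`. It remains to see that `u² (a / b) ≥
  -- u - 1/3`.
  · obtain ⟨u, rfl⟩ : ∃ u, p = u * δ := ⟨p / δ, by field_simp⟩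
    have hu : 0 < u := (pos_iff_pos_of_mul_pos h0).2 hδ
    have hu1 : u ≤ 1 := by nlinarith
    have ha := one_le_log_exp_sub_log hδ hδ1
    have hb := one_le_log_exp_sub_log h0 h1
    have hlδ := Real.log_nonpos hδ.le hδ1
    have hlu := Real.log_nonpos hu.le hu1
    have he : 0 < Real.exp 1 := Real.exp_pos 1
    set a := Real.log (Real.exp 1 - Real.log δ) with ha'
    set b := Real.log (Real.exp 1 - Real.log (u * δ)) with hb'
    have hba : b ≤ a + (-Real.log u) / Real.exp 1 := by
      have hz : 0 < Real.exp 1 - Real.log δ := by linarith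
      have hw : 0 < Real.exp 1 - Real.log (u * δ) := by
        rw [Real.log_mul hu.ne' hδ.ne']; linarith
      have := Real.log_le_sub_one_of_pos (div_pos hw hz)
      rw [Real.log_div hw.ne' hz.ne'] at this
      have e : (Real.exp 1 - Real.log (u * δ)) / (Real.exp 1 - Real.log δ) - 1 =
          (-Real.log u) / (Real.exp 1 - Real.log δ) := by
        rw [Real.log_mul hu.ne' hδ.ne']; field_simp; ring
      have : (-Real.log u) / (Real.exp 1 - Real.log δ) ≤ (-Real.log u) / Real.exp 1 :=
        div_le_div_of_nonneg_left (by linarith) he (by linarith)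
      linarith
    have e : truncSlope β δ (u * δ) * (logLogRate β (u * δ) * (u * δ) ^ 2) =
        δ * (u ^ 2 * (a / b)) := by
      rw [truncSlope, max_eq_right h, logLogRate, logLogRate, ← ha', ← hb']
      field_simp
    set y := (-Real.log u) / Real.exp 1
    have hy : 0 ≤ y := div_nonneg (by linarith) he.le
    have hab : 1 - y ≤ a / b := by
      rw [le_div_iff₀ (by linarith)]
      rcases le_total y 1 with hy1 | hy1 <;> nlinarith
    -- From `-u log u ≤ 1 / e` comes `u y ≤ 1 / e² < 1/7`. The conclusion then follows from `u² -
    -- 8u/7 + 1/3 = (u - 4/7)² + 1/147`.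
    have huy : u * y ≤ 1 / 7 := by
      have h2 := Real.log_le_sub_one_of_pos (show 0 < 1 / (Real.exp 1 * u) by positivity)
      rw [Real.log_div one_ne_zero (by positivity), Real.log_mul he.ne' hu.ne', Real.log_exp,
        Real.log_one] at h2
      have h3 : u * (-Real.log u) ≤ 1 / Real.exp 1 := by
        have : u * (-Real.log u) ≤ u * (1 / (Real.exp 1 * u)) := by gcongr; linarith
        refine this.trans_eq (by field_simp)
      have h4 : u * y = u * (-Real.log u) / Real.exp 1 := by simp only [y]; ring
      rw [h4, div_le_iff₀ he]
      refine h3.trans ?_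
      rw [div_le_iff₀ he]
      nlinarith [Real.exp_one_gt_d9]
    rw [e]
    have h5 : u - 1 / 3 ≤ u ^ 2 * (a / b) := by
      have h6 : u ^ 2 * (1 - y) ≤ u ^ 2 * (a / b) := by gcongr
      nlinarith [sq_nonneg (u - 4 / 7)]
    nlinarith

/-! ### Numerical comparison of the potential with the regret bound -/

/-- Expanded, this says `e log (e + L) ≤ L + 2e/3`. Replacing the logarithm by its tangent at `2e`
leaves a linear inequality, whose threshold lies just below `2.87`. -/
lemma exp_div_three_le {L : ℝ} (hL : 2.87 ≤ L) :
    logPrimitive L + Real.exp 1 / 3 ≤ L * Real.log (Real.exp 1 + L) := by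
  have he := Real.exp_one_gt_d9
  have he' := Real.exp_one_lt_d9
  have h0 : 0 < Real.exp 1 := Real.exp_pos 1
  have h2 := Real.log_le_sub_one_of_pos
    (show 0 < (Real.exp 1 + L) / (Real.exp 1 * 2) from div_pos (by linarith) (by linarith))
  rw [Real.log_div (by linarith) (by positivity), Real.log_mul (by positivity) (by norm_num),
    Real.log_exp] at h2
  have h3 := Real.log_two_lt_d9
  have h4 : Real.exp 1 * Real.log (Real.exp 1 + L) ≤
      Real.exp 1 * (Real.log 2 + (Real.exp 1 + L) / (Real.exp 1 * 2)) := by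
    gcongr; linarith
  have h5 : Real.exp 1 * (Real.log 2 + (Real.exp 1 + L) / (Real.exp 1 * 2)) =
      Real.exp 1 * Real.log 2 + (Real.exp 1 + L) / 2 := by field_simp
  unfold logPrimitive
  nlinarith

lemma logPrimitive_le {L : ℝ} (hL : 0 ≤ L) :
    logPrimitive L ≤ L * Real.log (Real.exp 1 + L) := by
  have h0 : 0 < Real.exp 1 := Real.exp_pos 1
  have h2 := Real.log_le_sub_one_of_pos
    (show 0 < (Real.exp 1 + L) / Real.exp 1 from div_pos (by linarith) (by linarith))
  rw [Real.log_div (by linarith) (by positivity), Real.log_exp] at h2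
  have h4 : Real.exp 1 * Real.log (Real.exp 1 + L) ≤
      Real.exp 1 * ((Real.exp 1 + L) / Real.exp 1) := by
    gcongr; linarith
  rw [mul_div_cancel₀ _ h0.ne'] at h4
  unfold logPrimitive
  nlinarith

lemma one_add_le_log {L : ℝ} (hL : 0 ≤ L) :
    1 + L / (Real.exp 1 + L) ≤ Real.log (Real.exp 1 + L) := by
  have h0 : 0 < Real.exp 1 := Real.exp_pos 1
  have h2 := Real.log_le_sub_one_of_pos
    (show 0 < Real.exp 1 / (Real.exp 1 + L) from div_pos (by linarith) (by linarith))
  rw [Real.log_div (by positivity) (by linarith), Real.log_exp] at h2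
  have : L / (Real.exp 1 + L) = 1 - Real.exp 1 / (Real.exp 1 + L) := by field_simp; ring
  linarith

/-- `L log (e + L)` is at least `c (1 + c / (2.72 + c))` for `c ≤ L`. -/
lemma mul_log_ge {c L : ℝ} (hc : 0 ≤ c) (hL : c ≤ L) :
    c * (1 + c / (2.72 + c)) ≤ L * Real.log (Real.exp 1 + L) := by
  have he' := Real.exp_one_lt_d9
  have h0 : 0 < Real.exp 1 := Real.exp_pos 1
  have h1 : c / (2.72 + c) ≤ c / (Real.exp 1 + c) :=
    div_le_div_of_nonneg_left hc (by linarith) (by linarith)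
  have h2 := one_add_le_log hc
  have h3 : Real.log (Real.exp 1 + c) ≤ Real.log (Real.exp 1 + L) :=
    Real.log_le_log (by linarith) (by linarith)
  have h4 : 0 ≤ c / (2.72 + c) := by positivity
  exact mul_le_mul hL (by linarith) (by linarith) (hc.trans hL)

lemma natCast_le_two_mul_log {T : ℕ} (h1 : 1 ≤ T) (h2 : T ≤ 2) :
    (T : ℝ) ≤ 2 * (Real.log T * Real.log (Real.exp 1 + Real.log T)) + 1 := by
  interval_cases T
  · simp
  · have := mul_log_ge (c := 0.69) (L := Real.log 2) (by norm_num) (by linarith [Real.log_two_gt_d9])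
    norm_num at this ⊢
    linarith

lemma log_ge_add {m x : ℝ} (hm : 0 < m) (hx : 0 < x) :
    Real.log m + (1 - m / x) ≤ Real.log x := by
  have := Real.log_le_sub_one_of_pos (div_pos hm hx)
  rw [Real.log_div hm.ne' hx.ne'] at this
  linarith

lemma log_pow_two_ge (k : ℕ) : 0.69314 * k ≤ Real.log (2 ^ k) := by
  rw [Real.log_pow]
  nlinarith [Real.log_two_gt_d9, (Nat.cast_nonneg k : (0 : ℝ) ≤ k)]

/-- The range of `T` is cut into blocks. A lower bound `c` for the logarithm at a point `m` not
above the block is tested against the largest `T` in the block. -/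
lemma natCast_le_four_mul_log {T : ℕ} (h1 : 3 ≤ T) (h2 : T ≤ 17) :
    (T : ℝ) ≤ 4 * (Real.log T * Real.log (Real.exp 1 + Real.log T)) + 1 := by
  have key : ∀ c m : ℝ, 0 ≤ c → 0 < m → m ≤ T → c ≤ Real.log m →
      (T : ℝ) ≤ 4 * (c * (1 + c / (2.72 + c))) + 1 →
      (T : ℝ) ≤ 4 * (Real.log T * Real.log (Real.exp 1 + Real.log T)) + 1 := by
    intro c m hc hm hmT hcm hT
    have := mul_log_ge hc (hcm.trans (Real.log_le_log hm hmT))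
    linarith
  have c3 : (1.02 : ℝ) ≤ Real.log 3 := by
    have := log_ge_add (m := 2) (x := 3) (by norm_num) (by norm_num)
    linarith [Real.log_two_gt_d9]
  have c4 : (1.386 : ℝ) ≤ Real.log 4 := by
    have := log_pow_two_ge 2; norm_num at this; linarith
  have c8 : (2.079 : ℝ) ≤ Real.log 8 := by
    have := log_pow_two_ge 3; norm_num at this; linarith
  have c12 : (2.41 : ℝ) ≤ Real.log 12 := by
    have := log_ge_add (m := 8) (x := 12) (by norm_num) (by norm_num)
    norm_num at this; linarith
  have c16 : (2.77 : ℝ) ≤ Real.log 16 := by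
    have := log_pow_two_ge 4; norm_num at this; linarith
  have cast : ∀ {n : ℕ}, T ≤ n → (T : ℝ) ≤ n := fun h => by exact_mod_cast h
  rcases le_or_gt T 3 with h | h
  · exact key _ 3 (by norm_num) (by norm_num) (by exact_mod_cast h1) c3
      ((cast h).trans (by norm_num))
  rcases le_or_gt T 8 with h' | h'
  · exact key _ 4 (by norm_num) (by norm_num) (by exact_mod_cast h) c4
      ((cast h').trans (by norm_num))
  rcases le_or_gt T 12 with h'' | h''
  · exact key _ 8 (by norm_num) (by norm_num) (by exact_mod_cast h'.le) c8
      ((cast h'').trans (by norm_num))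
  rcases le_or_gt T 15 with h3 | h3
  · exact key _ 12 (by norm_num) (by norm_num) (by exact_mod_cast h''.le) c12
      ((cast h3).trans (by norm_num))
  · exact key _ 16 (by norm_num) (by norm_num) (by exact_mod_cast h3) c16
      ((cast h2).trans (by norm_num))

/-- The numerical comparison behind the regret bound: `x` is bounded by `T`, and, for `T ≥ 3`,
by the potential estimate. -/
lemma le_of_potential_bound {N T : ℕ} (hN : 2 ≤ N) (hT : 1 ≤ T) {β g x : ℝ}
    (hβ : 0 < β) (hβ1 : β ≤ 1) (hg : 0 < g) (hg1 : g ≤ 1) (hx : x ≤ T)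
    (hpot : 3 ≤ T → x ≤ ((N : ℝ) - 1) * (logPrimitive (Real.log T) / β + Real.exp 1 / 3)) :
    x ≤ N / (β * g) * Real.log T * Real.log (Real.exp 1 + Real.log T) + 1 := by
  set L := Real.log T with hL
  set F := L * Real.log (Real.exp 1 + L) with hF
  have hL0 : 0 ≤ L := Real.log_nonneg (by exact_mod_cast hT)
  have hN' : (2 : ℝ) ≤ N := by exact_mod_cast hN
  have hF0 : 0 ≤ F := (mul_log_ge le_rfl hL0).trans' (by norm_num)
  have hbg : F / β ≤ F / (β * g) :=
    div_le_div_of_nonneg_left hF0 (by positivity) (mul_le_of_le_one_right hβ.le hg1)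
  have hb : F ≤ F / β := le_div_self hF0 hβ hβ1
  have e : N / (β * g) * L * Real.log (Real.exp 1 + L) = N * (F / (β * g)) := by
    rw [hF]; ring
  rw [e]
  suffices h : x ≤ N * (F / β) + 1 by nlinarith
  -- The trivial bound `x ≤ T` serves `T < 3`, and `T < 18` when `N ≥ 4`. Otherwise the potential
  -- bound is used: for `N ≤ 3` the spare `F / β + 1 ≥ 2` pays for `(N - 1) e / 3`; for `T ≥ 18` the
  -- slack between `logPrimitive L` and `F` pays `e / 3` for each arm.
  rcases Nat.lt_or_ge T 3 with h3 | h3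
  · have := natCast_le_two_mul_log hT (by omega)
    nlinarith
  have hL1 : 1 ≤ L := by
    have h := log_ge_add (m := 2) (x := T) (by norm_num) (by positivity)
    have h' : (2 : ℝ) / T ≤ 2 / 3 :=
      div_le_div_of_nonneg_left (by norm_num) (by norm_num) (by exact_mod_cast h3)
    linarith [Real.log_two_gt_d9]
  have hlog1 : 1 ≤ Real.log (Real.exp 1 + L) :=
    (Real.le_log_iff_exp_le (by linarith [Real.exp_pos 1])).2 (by linarith)
  have hF1 : 1 ≤ F := by nlinarith
  have hHF : logPrimitive L / β ≤ F / β := by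
    gcongr; exact logPrimitive_le hL0
  have he := Real.exp_one_lt_d9
  rcases Nat.lt_or_ge N 4 with h4 | h4
  · have hN3 : (N : ℝ) ≤ 3 := by exact_mod_cast Nat.lt_succ_iff.1 h4
    refine (hpot h3).trans ?_
    nlinarith
  rcases Nat.lt_or_ge T 18 with h18 | h18
  · have := natCast_le_four_mul_log h3 (by omega)
    have hN4 : (4 : ℝ) ≤ N := by exact_mod_cast h4
    nlinarith
  · have hL18 : 2.87 ≤ L := by
      have h := log_ge_add (m := 2 ^ 4) (x := T) (by norm_num) (by positivity)
      have h' : (2 : ℝ) ^ 4 / T ≤ 2 ^ 4 / 18 :=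
        div_le_div_of_nonneg_left (by norm_num) (by norm_num) (by exact_mod_cast h18)
      have := log_pow_two_ge 4
      norm_num at h' this h
      linarith
    have h1 := exp_div_three_le hL18
    have h2 : logPrimitive L / β + Real.exp 1 / 3 ≤ F / β := by
      have : Real.exp 1 / 3 ≤ Real.exp 1 / 3 / β := le_div_self (by positivity) hβ hβ1
      calc _ ≤ logPrimitive L / β + Real.exp 1 / 3 / β := by linarith
        _ = (logPrimitive L + Real.exp 1 / 3) / β := by ring
        _ ≤ F / β := by gcongr
    refine (hpot h3).trans ?_
    have : 0 ≤ F / β := by positivity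
    nlinarith

/-! ### One step of the algorithm and its drift -/

/-- `p` is a probability vector with positive entries. -/
def IsInterior {Arm : Type*} [Fintype Arm] (p : Arm → ℝ) : Prop := (∀ a, 0 < p a) ∧ ∑ a, p a = 1

/-- The step taken when the played arm has reward `1`. -/
noncomputable def move {Arm : Type*} [Fintype Arm] [DecidableEq Arm] (α : ℝ → ℝ) (p : Arm → ℝ)
    (a l : Arm) : Arm → ℝ := step α p a l fun _ => true

/-- The mean increment of `f` over one step from `p`, when the leading arm is `l`. -/
noncomputable def drift {Arm : Type*} [Fintype Arm] [DecidableEq Arm] (r : Arm → ℝ) (α : ℝ → ℝ)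
    (p : Arm → ℝ) (l : Arm) (f : (Arm → ℝ) → ℝ) : ℝ :=
  ∑ a, p a * r a * (f (move α p a l) - f p)

/-- The conditional probability that `o = (a, l, ρ)` are the arm played, the leading arm and the
rewards, given that the current probability vector is `p`. -/
noncomputable def outcomeWeight {Arm : Type*} [Fintype Arm] [DecidableEq Arm] (r p : Arm → ℝ)
    (o : Arm × Arm × (Arm → Bool)) : ℝ :=
  p o.1 * (if o.2.1 ∈ leaders p then 1 / ((leaders p).card : ℝ) else 0) *
    ∏ b, (if o.2.2 b then r b else 1 - r b)

/-- The mean of `f` after one step from `p`. -/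
noncomputable def stepMean {Arm : Type*} [Fintype Arm] [DecidableEq Arm] (r : Arm → ℝ)
    (α : ℝ → ℝ) (p : Arm → ℝ) (f : (Arm → ℝ) → ℝ) : ℝ :=
  ∑ o : Arm × Arm × (Arm → Bool), outcomeWeight r p o * f (step α p o.1 o.2.1 o.2.2)

lemma armUpdate_true {Arm : Type*} [DecidableEq Arm] {α : ℝ → ℝ} {p : Arm → ℝ} {a b l : Arm}
    (h : p b ≠ 0) :
    armUpdate α p a l (fun _ => true) b = p b + (if a = b then α (p b) * p b else 0) -
      (if a = l then α (p b) * p b ^ 2 / p l else 0) := by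
  unfold armUpdate playInd
  rw [show rewardVal true = 1 from rfl]
  split_ifs <;> field_simp <;> ring

section Leaders

variable {Arm : Type*} [Fintype Arm] {p : Arm → ℝ} {l : Arm}

lemma mem_leaders : l ∈ leaders p ↔ ∀ b, p b ≤ p l := by simp [leaders]

lemma leaders_nonempty [Nonempty Arm] (p : Arm → ℝ) : (leaders p).Nonempty := by
  obtain ⟨l, hl⟩ := Finite.exists_max p
  exact ⟨l, mem_leaders.2 hl⟩

lemma IsInterior.le_one (hp : IsInterior p) (a : Arm) : p a ≤ 1 := by
  rw [← hp.2]
  exact Finset.single_le_sum (fun b _ => (hp.1 b).le) (Finset.mem_univ a)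

lemma mul_sq_div_le {α : ℝ → ℝ} {b : Arm} (hp : IsInterior p)
    (hl : l ∈ leaders p) (h0 : 0 ≤ α (p b)) :
    α (p b) * p b ^ 2 / p l ≤ α (p b) * p b := by
  rw [div_le_iff₀ (hp.1 l)]
  have := mem_leaders.1 hl b
  nlinarith [mul_nonneg h0 (hp.1 b).le]

end Leaders

section Finite

variable {Arm : Type*} [Fintype Arm] [DecidableEq Arm] {α : ℝ → ℝ} {p r : Arm → ℝ}
  {a b l : Arm}

lemma IsInterior.add_le_one (hp : IsInterior p) (h : a ≠ b) : p a + p b ≤ 1 := by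
  rw [← hp.2, ← Finset.sum_pair h]
  exact Finset.sum_le_sum_of_subset_of_nonneg (Finset.subset_univ _) fun b _ _ => (hp.1 b).le

lemma IsInterior.le_half (hp : IsInterior p) (hl : l ∈ leaders p) (h : b ≠ l) : p b ≤ 1 / 2 := by
  linarith [hp.add_le_one h, mem_leaders.1 hl b]

lemma IsInterior.sum_erase (hp : IsInterior p) (a : Arm) :
    ∑ b ∈ Finset.univ.erase a, p b = 1 - p a := by
  rw [← hp.2, ← Finset.add_sum_erase _ _ (Finset.mem_univ a)]; ring

lemma move_of_ne (hp : IsInterior p) (h : b ≠ l) :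
    move α p a l b = p b + (if a = b then α (p b) * p b else 0) -
      (if a = l then α (p b) * p b ^ 2 / p l else 0) := by
  rw [move, step, if_neg h, armUpdate_true (hp.1 b).ne']

lemma move_self (hp : IsInterior p) :
    move α p a l l = p l - ∑ b ∈ Finset.univ.erase l, ((if a = b then α (p b) * p b else 0) -
      (if a = l then α (p b) * p b ^ 2 / p l else 0)) := by
  have h1 := hp.sum_erase l
  have h2 : ∑ b ∈ Finset.univ.erase l, armUpdate α p a l (fun _ => true) b =
      ∑ b ∈ Finset.univ.erase l, (p b + ((if a = b then α (p b) * p b else 0) -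
      (if a = l then α (p b) * p b ^ 2 / p l else 0))) :=
    Finset.sum_congr rfl fun b _ => by rw [armUpdate_true (hp.1 b).ne']; ring
  rw [move, step, if_pos rfl, h2, Finset.sum_add_distrib, h1]
  ring

lemma move_self_of_ne (hp : IsInterior p) (h : a ≠ l) :
    move α p a l l = p l - α (p a) * p a := by
  rw [move_self hp]
  simp [h]

lemma move_self_self (hp : IsInterior p) :
    move α p l l l = p l + ∑ b ∈ Finset.univ.erase l, α (p b) * p b ^ 2 / p l := by
  rw [move_self hp, sub_eq_add_neg, ← Finset.sum_neg_distrib]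
  congr 1
  refine Finset.sum_congr rfl fun b hb => ?_
  simp [(Finset.ne_of_mem_erase hb).symm]

/-- All increments carry the reward of the played arm as a factor, so a zero reward leaves the
vector unchanged. -/
lemma step_eq (hp : IsInterior p) (ρ : Arm → Bool) :
    step α p a l ρ = if ρ a then move α p a l else p := by
  have key : ∀ b, armUpdate α p a l ρ b =
      if ρ a then armUpdate α p a l (fun _ => true) b else p b := by
    intro b
    unfold armUpdate playInd rewardVal
    by_cases h1 : a = b <;> by_cases h2 : a = l <;> by_cases h3 : ρ a <;> simp_all
  have h := hp.sum_erase l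
  funext b
  unfold move step
  simp only [key]
  by_cases h1 : b = l <;> by_cases h2 : ρ a = true <;> simp [h1, h2, h]

lemma sum_step (ρ : Arm → Bool) : ∑ b, step α p a l ρ b = 1 := by
  rw [← Finset.add_sum_erase _ _ (Finset.mem_univ l)]
  have : ∑ b ∈ Finset.univ.erase l, step α p a l ρ b =
      ∑ b ∈ Finset.univ.erase l, armUpdate α p a l ρ b :=
    Finset.sum_congr rfl fun b hb => by rw [step, if_neg (Finset.ne_of_mem_erase hb)]
  rw [this, step, if_pos rfl]
  ring

/-- A non-leading arm loses at most the fraction `α < 1` of its mass, because `p b ≤ p l`. The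
leader pays at most `α (p a) * p a < p a ≤ p l`. -/
lemma move_pos (hp : IsInterior p) (hl : l ∈ leaders p) (h0 : ∀ b ≠ l, 0 ≤ α (p b))
    (h1 : ∀ b ≠ l, α (p b) < 1) (a b : Arm) : 0 < move α p a l b := by
  by_cases hb : b = l
  · subst hb
    by_cases ha : a = b
    · subst ha
      rw [move_self_self hp]
      have : 0 ≤ ∑ c ∈ Finset.univ.erase a, α (p c) * p c ^ 2 / p a :=
        Finset.sum_nonneg fun c hc => div_nonneg
          (mul_nonneg (h0 c (Finset.ne_of_mem_erase hc)) (sq_nonneg _)) (hp.1 a).le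
      linarith [hp.1 a]
    · rw [move_self_of_ne hp ha]
      nlinarith [mem_leaders.1 hl a, h1 a ha, hp.1 a]
  · rw [move_of_ne hp hb]
    have h2 := mul_sq_div_le hp hl (h0 b hb)
    have h3 := mul_nonneg (h0 b hb) (hp.1 b).le
    have h4 := h1 b hb
    have h5 := hp.1 b
    split_ifs <;> nlinarith

lemma isInterior_move (hp : IsInterior p) (hl : l ∈ leaders p) (h0 : ∀ b ≠ l, 0 ≤ α (p b))
    (h1 : ∀ b ≠ l, α (p b) < 1) (a : Arm) : IsInterior (move α p a l) :=
  ⟨move_pos hp hl h0 h1 a, sum_step _⟩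

lemma drift_comp_of_ne (hp : IsInterior p) (h : b ≠ l) (g : ℝ → ℝ) :
    drift r α p l (fun q => g (q b)) =
      p b * r b * (g (p b + α (p b) * p b) - g (p b)) +
      p l * r l * (g (p b - α (p b) * p b ^ 2 / p l) - g (p b)) := by
  have h1 : ∀ a, a ∉ ({b, l} : Finset Arm) →
      p a * r a * (g (move α p a l b) - g (p b)) = 0 := by
    intro a ha
    simp only [Finset.mem_insert, Finset.mem_singleton, not_or] at ha
    simp [move_of_ne hp h, ha.1, ha.2]
  unfold drift
  rw [← Finset.sum_subset (Finset.subset_univ {b, l}) fun a _ ha => h1 a ha, Finset.sum_pair h]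
  simp [move_of_ne hp h, h, h.symm]

lemma drift_comp_self (hp : IsInterior p) (g : ℝ → ℝ) :
    drift r α p l (fun q => g (q l)) =
      p l * r l * (g (p l + ∑ b ∈ Finset.univ.erase l, α (p b) * p b ^ 2 / p l) - g (p l)) +
      ∑ a ∈ Finset.univ.erase l, p a * r a * (g (p l - α (p a) * p a) - g (p l)) := by
  unfold drift
  rw [← Finset.add_sum_erase _ _ (Finset.mem_univ l)]
  beta_reduce
  rw [move_self_self hp]
  congr 1
  exact Finset.sum_congr rfl fun a ha => by
    rw [move_self_of_ne hp (Finset.ne_of_mem_erase ha)]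

/-- The divisions by `p b` and `p l` in the update cancel the probabilities of playing these arms,
so only the difference of mean rewards survives. -/
lemma drift_eval_of_ne (hp : IsInterior p) (h : b ≠ l) :
    drift r α p l (fun q => q b) = α (p b) * p b ^ 2 * (r b - r l) := by
  rw [drift_comp_of_ne hp h fun x => x]
  have := (hp.1 l).ne'
  field_simp
  ring

lemma drift_eval_self (hp : IsInterior p) :
    drift r α p l (fun q => q l) =
      ∑ b ∈ Finset.univ.erase l, α (p b) * p b ^ 2 * (r l - r b) := by
  rw [drift_comp_self hp fun x => x, add_sub_cancel_left, Finset.mul_sum,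
    ← Finset.sum_add_distrib]
  refine Finset.sum_congr rfl fun b _ => ?_
  have := (hp.1 l).ne'
  field_simp
  ring

lemma sum_bernoulli (r : Arm → ℝ) (a : Arm) (h : Bool → ℝ) :
    ∑ ρ : Arm → Bool, (∏ b, (if ρ b then r b else 1 - r b)) * h (ρ a) =
      r a * h true + (1 - r a) * h false := by
  have h1 : ∀ ρ : Arm → Bool, (∏ b, (if ρ b then r b else 1 - r b)) * h (ρ a) =
      ∏ b, ((if ρ b then r b else 1 - r b) * (if b = a then h (ρ b) else 1)) := by
    intro ρ
    rw [Finset.prod_mul_distrib]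
    simp
  have h2 := Finset.prod_univ_sum (fun _ : Arm => (Finset.univ : Finset Bool))
    (fun b c => ((if c then r b else 1 - r b) * (if b = a then h c else 1) : ℝ))
  rw [Fintype.piFinset_univ] at h2
  rw [Finset.sum_congr rfl fun ρ _ => h1 ρ, ← h2, Finset.prod_eq_single a]
  · simp
  · intro b _ hb
    simp [hb]
  · simp

/-- The rewards integrate out through `sum_bernoulli`, leaving an average over tied leaders. A drift
bound valid for every possible leader therefore passes to the mean. -/
lemma stepMean_eq [Nonempty Arm] (hp : IsInterior p) (f : (Arm → ℝ) → ℝ) :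
    stepMean r α p f = f p + (∑ l ∈ leaders p, drift r α p l f) / (leaders p).card := by
  have hc : ((leaders p).card : ℝ) ≠ 0 := by
    simpa using (leaders_nonempty p).ne_empty
  have h1 : ∀ a l : Arm, ∑ ρ : Arm → Bool, outcomeWeight r p (a, l, ρ) * f (step α p a l ρ) =
      (if l ∈ leaders p then 1 / ((leaders p).card : ℝ) else 0) *
        (p a * f p + p a * r a * (f (move α p a l) - f p)) := by
    intro a l
    have := sum_bernoulli r a fun c => if c then f (move α p a l) else f p
    rw [Finset.sum_congr rfl fun ρ _ => show outcomeWeight r p (a, l, ρ) * f (step α p a l ρ) =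
      (if l ∈ leaders p then 1 / ((leaders p).card : ℝ) else 0) * p a *
      ((∏ b, (if ρ b then r b else 1 - r b)) * (if ρ a then f (move α p a l) else f p)) by
        rw [step_eq hp, outcomeWeight, apply_ite f]; ring, ← Finset.mul_sum, this]
    simp only [if_true]
    simp
    split_ifs <;> ring
  unfold stepMean
  rw [Fintype.sum_prod_type]
  simp only [Fintype.sum_prod_type]
  simp only [h1]
  rw [Finset.sum_comm]
  simp only [← Finset.mul_sum, Finset.sum_add_distrib, ← Finset.sum_mul, hp.2, one_mul]
  simp only [ite_mul, zero_mul, Finset.sum_ite_mem, Finset.univ_inter]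
  rw [← Finset.mul_sum, Finset.sum_add_distrib, Finset.sum_const, nsmul_eq_mul]
  unfold drift
  field_simp

lemma sum_outcomeWeight [Nonempty Arm] (hp : IsInterior p) : ∑ o, outcomeWeight r p o = 1 := by
  have := stepMean_eq (r := r) (α := id) hp fun _ => 1
  simpa [stepMean, drift] using this

lemma outcomeWeight_nonneg (hr : ∀ a, r a ∈ Set.Icc (0 : ℝ) 1) (hp : ∀ a, 0 ≤ p a)
    (o : Arm × Arm × (Arm → Bool)) : 0 ≤ outcomeWeight r p o := by
  refine mul_nonneg (mul_nonneg (hp _) ?_) (Finset.prod_nonneg fun b _ => ?_)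
  · split_ifs <;> positivity
  · have := hr b
    split_ifs <;> linarith [this.1, this.2]

lemma stepMean_le [Nonempty Arm] (hp : IsInterior p) {f : (Arm → ℝ) → ℝ} {c : ℝ}
    (h : ∀ l ∈ leaders p, drift r α p l f ≤ c) : stepMean r α p f ≤ f p + c := by
  have hc : 0 < ((leaders p).card : ℝ) := by
    exact_mod_cast (leaders_nonempty p).card_pos
  rw [stepMean_eq hp]
  gcongr
  rw [div_le_iff₀ hc]
  calc _ ≤ ∑ l ∈ leaders p, c := Finset.sum_le_sum h
    _ = _ := by rw [Finset.sum_const, nsmul_eq_mul, mul_comm]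

lemma le_stepMean [Nonempty Arm] (hp : IsInterior p) {f : (Arm → ℝ) → ℝ} {c : ℝ}
    (h : ∀ l ∈ leaders p, c ≤ drift r α p l f) : f p + c ≤ stepMean r α p f := by
  have hc : 0 < ((leaders p).card : ℝ) := by
    exact_mod_cast (leaders_nonempty p).card_pos
  rw [stepMean_eq hp]
  gcongr
  rw [le_div_iff₀ hc]
  calc _ = ∑ l ∈ leaders p, c := by rw [Finset.sum_const, nsmul_eq_mul, mul_comm]
    _ ≤ _ := Finset.sum_le_sum h

end Finite

/-! ### The Lyapunov function of the optimal arm -/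

lemma one_div_sq_add_sub_le {x a : ℝ} (hx : 0 < x) (ha : 0 ≤ a) :
    1 / (x + a * x) ^ 2 - 1 / x ^ 2 ≤ 1 / x ^ 2 * (-2 * a + 3 * a ^ 2) := by
  have e : 1 / (x + a * x) ^ 2 = 1 / x ^ 2 * (1 / (1 + a) ^ 2) := by
    have : (1 + a) ≠ 0 := by linarith
    rw [show x + a * x = x * (1 + a) by ring]; field_simp
  have h : 1 / (1 + a) ^ 2 ≤ 1 - 2 * a + 3 * a ^ 2 := by
    rw [div_le_iff₀ (by positivity)]
    nlinarith [pow_nonneg ha 3, pow_nonneg ha 4]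
  rw [e]
  nlinarith [show 0 < 1 / x ^ 2 by positivity]

lemma one_div_sq_sub_sub_le {x z : ℝ} (hx : 0 < x) (hz : z ≤ 1 / 2) :
    1 / (x - z * x) ^ 2 - 1 / x ^ 2 ≤ 1 / x ^ 2 * (2 * z + 12 * z ^ 2) := by
  have e : 1 / (x - z * x) ^ 2 = 1 / x ^ 2 * (1 / (1 - z) ^ 2) := by
    have : (1 - z) ≠ 0 := by linarith
    rw [show x - z * x = x * (1 - z) by ring]; field_simp
  have h : 1 / (1 - z) ^ 2 ≤ 1 + 2 * z + 12 * z ^ 2 := by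
    have : 0 < 1 - z := by linarith
    rw [div_le_iff₀ (by positivity)]
    have : (1 / 4) ≤ (1 - z) ^ 2 := by nlinarith
    nlinarith [sq_nonneg z]
  rw [e]
  nlinarith [show 0 < 1 / x ^ 2 by positivity]

/-- Near the boundary the inverse square has a drift of order `-α / x`. -/
lemma inv_sq_drift_le {x m a s t g : ℝ} (hx : 0 < x) (hxm : x ≤ m) (ha : 0 ≤ a) (hag : 15 * a ≤ g)
    (hg : g ≤ s - t) (ht : 0 ≤ t) (hs : s ≤ 1) :
    x * s * (1 / (x + a * x) ^ 2 - 1 / x ^ 2) +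
      m * t * (1 / (x - a * x ^ 2 / m) ^ 2 - 1 / x ^ 2) ≤ -(g * (a / x)) := by
  have hm : 0 < m := hx.trans_le hxm
  have hs0 : 0 ≤ s := by linarith
  have hz : a * x / m ≤ a := by
    rw [div_le_iff₀ hm]; nlinarith
  have h1 := one_div_sq_add_sub_le hx ha
  have h2 := one_div_sq_sub_sub_le hx (show a * x / m ≤ 1 / 2 by linarith)
  rw [show a * x / m * x = a * x ^ 2 / m by ring] at h2
  have h3 := mul_le_mul_of_nonneg_left h1 (show 0 ≤ x * s by positivity)
  have h4 := mul_le_mul_of_nonneg_left h2 (show 0 ≤ m * t by positivity)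
  have e3 : x * s * (1 / x ^ 2 * (-2 * a + 3 * a ^ 2)) = a / x * (s * (-2 + 3 * a)) := by
    field_simp
  have e4 : m * t * (1 / x ^ 2 * (2 * (a * x / m) + 12 * (a * x / m) ^ 2)) =
      a / x * (t * (2 + 12 * (a * x / m))) := by
    field_simp
  rw [e3] at h3
  rw [e4] at h4
  -- The second-order terms, with coefficients `3` and `12`, cost at most `15 a ≤ g`, against a
  -- first-order gain `2 (s - t) ≥ 2 g`.
  have h5 : s * (-2 + 3 * a) + t * (2 + 12 * (a * x / m)) ≤ -g := by nlinarith
  have h6 := mul_le_mul_of_nonneg_left h5 (show 0 ≤ a / x by positivity)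
  linarith

lemma inv_sq_sub_le {x y d : ℝ} (hd : 0 < d) (hdx : d ≤ x - y) (hy : 0 ≤ y) (hx : x ≤ 1) :
    1 / (x - y) ^ 2 - 1 / x ^ 2 ≤ 2 / d ^ 4 * y := by
  have h0 : 0 < x - y := by linarith
  have h1 : 0 < x := by linarith
  have e : 1 / (x - y) ^ 2 - 1 / x ^ 2 = y * (2 * x - y) / ((x - y) ^ 2 * x ^ 2) := by
    field_simp; ring
  have h2 : d ^ 4 ≤ (x - y) ^ 2 * x ^ 2 := by
    rw [show d ^ 4 = d ^ 2 * d ^ 2 by ring]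
    gcongr
    linarith
  rw [e, show 2 / d ^ 4 * y = y * 2 / d ^ 4 by ring]
  gcongr
  linarith

lemma one_div_card_le {Arm : Type*} [Fintype Arm] {p : Arm → ℝ} {l : Arm} (hp : IsInterior p) (hl : l ∈ leaders p) :
    1 / (Fintype.card Arm : ℝ) ≤ p l := by
  have : 1 ≤ Fintype.card Arm * p l := by
    rw [← hp.2, ← nsmul_eq_mul, ← Finset.card_univ, ← Finset.sum_const]
    exact Finset.sum_le_sum fun b _ => mem_leaders.1 hl b
  have h : 0 < (Fintype.card Arm : ℝ) := by
    exact_mod_cast Fintype.card_pos_iff.2 ⟨l⟩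
  rw [div_le_iff₀ h]
  linarith

section Drift

variable {Arm : Type*} [Fintype Arm] [DecidableEq Arm] {p r : Arm → ℝ}
  {l aStar : Arm} {β g : ℝ}

lemma isInterior_step (hβ : 0 < β) (hβ1 : β ≤ 1) (hp : IsInterior p) (hl : l ∈ leaders p)
    (a : Arm) (ρ : Arm → Bool) : IsInterior (step (logLogRate β) p a l ρ) := by
  rw [step_eq hp]
  split_ifs
  · exact isInterior_move hp hl (fun b _ => (logLogRate_pos hβ (hp.1 b) (hp.le_one b)).le)
      (fun b hb => logLogRate_lt_one hβ1 (hp.1 b) (by linarith [hp.le_half hl hb])) a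
  · exact hp

lemma isInterior_move_logLogRate (hβ : 0 < β) (hβ1 : β ≤ 1) (hp : IsInterior p)
    (hl : l ∈ leaders p) (a : Arm) : IsInterior (move (logLogRate β) p a l) :=
  isInterior_step hβ hβ1 hp hl a _

/-- If the optimal arm does not lead, a function `K (1 - x) + 1 / x ^ 2` of its probability `x`
decreases in mean by a fixed amount. -/
lemma lyapunov_drift_of_ne (hr : ∀ a, r a ∈ Set.Icc (0 : ℝ) 1)
    (hg : ∀ a ≠ aStar, g ≤ r aStar - r a) (hg0 : 0 < g) (hβ : 0 < β) (hβ1 : β ≤ 1)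
    {ε : ℝ} (hε : 0 < ε) (hε1 : ε ≤ 1) (hεα : 15 * logLogRate β ε ≤ g) {K : ℝ} (hK0 : 0 ≤ K)
    (hK : 1 / (ε * (1 - logLogRate β (1 / 2))) ^ 2 + 1 ≤ K * (g * (β * ε ^ 3 / 2)))
    (hp : IsInterior p) (hl : l ∈ leaders p) (hne : aStar ≠ l) :
    drift r (logLogRate β) p l (fun q => K * (1 - q aStar) + 1 / q aStar ^ 2) ≤
      -min 1 (g * (β / 2)) := by
  rw [drift_comp_of_ne hp hne fun x => K * (1 - x) + 1 / x ^ 2]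
  have hx0 := hp.1 aStar
  have hx12 := hp.le_half hl hne
  have hxm := mem_leaders.1 hl aStar
  have hm1 := hp.le_one l
  have ha0 := logLogRate_pos hβ hx0 (by linarith)
  have ha1 := logLogRate_lt_one hβ1 hx0 (by linarith)
  have haβ := half_mul_le_logLogRate hβ hx0 (by linarith)
  have hα12 := logLogRate_mono hβ hx0 hx12 (by norm_num)
  have hα121 := logLogRate_lt_one (p := 1 / 2) hβ1 (by norm_num) (by norm_num)
  have hgl := hg l hne.symm
  have hrl := hr l
  have hrs := hr aStar
  have hmono : ε ≤ p aStar → logLogRate β ε ≤ logLogRate β (p aStar) := fun h =>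
    logLogRate_mono hβ hε h (by linarith)
  have hmono' : p aStar ≤ ε → ε ≤ 1 → 15 * logLogRate β (p aStar) ≤ g := fun h h' => by
    linarith [logLogRate_mono hβ hx0 h h']
  set x := p aStar
  set m := p l
  set a := logLogRate β x
  have hm0 : 0 < m := hp.1 l
  have elin : x * r aStar * (K * (1 - (x + a * x)) - K * (1 - x)) +
      m * r l * (K * (1 - (x - a * x ^ 2 / m)) - K * (1 - x)) =
      -(K * (a * x ^ 2 * (r aStar - r l))) := by
    field_simp; ring
  have esplit : x * r aStar * (K * (1 - (x + a * x)) + 1 / (x + a * x) ^ 2 -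
        (K * (1 - x) + 1 / x ^ 2)) +
      m * r l * (K * (1 - (x - a * x ^ 2 / m)) + 1 / (x - a * x ^ 2 / m) ^ 2 -
        (K * (1 - x) + 1 / x ^ 2)) =
      -(K * (a * x ^ 2 * (r aStar - r l))) +
      (x * r aStar * (1 / (x + a * x) ^ 2 - 1 / x ^ 2) +
        m * r l * (1 / (x - a * x ^ 2 / m) ^ 2 - 1 / x ^ 2)) := by
    rw [← elin]; ring
  rw [esplit]
  have hlin : K * (a * x ^ 2 * g) ≤ K * (a * x ^ 2 * (r aStar - r l)) := by gcongr
  -- For `x < ε` the inverse square alone decreases, by at least `g α(x) / x ≥ g β / 2`. For `x ≥ ε`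
  -- its drift is at most a constant, which `hK` lets the linear term outweigh.
  rcases lt_or_ge x ε with h | h
  · have ha15 : 15 * a ≤ g := hmono' h.le hε1
    have h1 := inv_sq_drift_le hx0 hxm ha0.le ha15 hgl hrl.1 hrs.2
    have h2 : g * (β / 2) ≤ g * (a / x) :=
      mul_le_mul_of_nonneg_left ((le_div_iff₀ hx0).2 (by linarith)) hg0.le
    have h3 : 0 ≤ K * (a * x ^ 2 * g) := by positivity
    have := min_le_right 1 (g * (β / 2))
    linarith
  · have h1 : x * r aStar * (1 / (x + a * x) ^ 2 - 1 / x ^ 2) ≤ 0 := by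
      refine mul_nonpos_of_nonneg_of_nonpos (mul_nonneg hx0.le hrs.1) (sub_nonpos.2 ?_)
      gcongr
      exact le_add_of_nonneg_right (by positivity)
    have hdiv : a * x ^ 2 / m ≤ a * x := by
      rw [div_le_iff₀ hm0]; nlinarith [mul_pos ha0 hx0]
    have h2 : 1 / (x - a * x ^ 2 / m) ^ 2 ≤ 1 / (ε * (1 - logLogRate β (1 / 2))) ^ 2 := by
      have : 0 < ε * (1 - logLogRate β (1 / 2)) := mul_pos hε (by linarith)
      gcongr
      have : ε * (1 - logLogRate β (1 / 2)) ≤ x * (1 - a) :=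
        mul_le_mul h (by linarith) (by linarith) hx0.le
      linarith
    have h3 : m * r l * (1 / (x - a * x ^ 2 / m) ^ 2 - 1 / x ^ 2) ≤
        1 / (ε * (1 - logLogRate β (1 / 2))) ^ 2 := by
      have h4 : 0 ≤ 1 / x ^ 2 := by positivity
      have h5 : m * r l ≤ 1 := mul_le_one₀ hm1 hrl.1 hrl.2
      have h6 : 0 ≤ m * r l := mul_nonneg hm0.le hrl.1
      have h7 : 0 ≤ 1 / (x - a * x ^ 2 / m) ^ 2 := by positivity
      nlinarith
    have h4 : K * (g * (β * ε ^ 3 / 2)) ≤ K * (a * x ^ 2 * g) := by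
      have : β * ε / 2 * ε ^ 2 ≤ a * x ^ 2 := by
        have h5 : β * ε ≤ β * x := by gcongr
        exact mul_le_mul (by linarith) (by gcongr) (by positivity) ha0.le
      have h6 : g * (β * ε / 2 * ε ^ 2) ≤ g * (a * x ^ 2) := by gcongr
      have h7 := mul_le_mul_of_nonneg_left h6 hK0
      linarith
    have := min_le_left 1 (g * (β / 2))
    linarith

/-- As leader, the optimal arm has probability at least `1 / N`, and at least `d` even after losing
mass, so the inverse square gains in mean at most `2 / d⁴` times `∑ α(p_b) p_b²`. The linear term
loses at least `K g` times this sum. By `hK` a full multiple of the sum remains; it is at least `(β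
/ 2) ∑ p_b³`, and the power mean inequality brings in `(1 - x)³`. -/
lemma lyapunov_drift_self (hr : ∀ a, r a ∈ Set.Icc (0 : ℝ) 1)
    (hg : ∀ a ≠ aStar, g ≤ r aStar - r a) (hβ : 0 < β) (hβ1 : β ≤ 1)
    {K : ℝ} (hK0 : 0 ≤ K)
    (hK : 2 / ((1 - logLogRate β (1 / 2)) / Fintype.card Arm) ^ 4 + 1 ≤ K * g)
    (hp : IsInterior p) (hl : aStar ∈ leaders p) :
    drift r (logLogRate β) p aStar (fun q => K * (1 - q aStar) + 1 / q aStar ^ 2) ≤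
      -(β / 2 / Fintype.card Arm ^ 2 * (1 - p aStar) ^ 3) := by
  rw [drift_comp_self hp fun x => K * (1 - x) + 1 / x ^ 2]
  have hN : 0 < (Fintype.card Arm : ℝ) := by
    exact_mod_cast Fintype.card_pos_iff.2 ⟨aStar⟩
  have hx0 := hp.1 aStar
  have hx1 := hp.le_one aStar
  have hxN := one_div_card_le hp hl
  have hα121 := logLogRate_lt_one (p := 1 / 2) hβ1 (by norm_num) (by norm_num)
  have hα := fun b => logLogRate_pos hβ (hp.1 b) (hp.le_one b)
  set d := (1 - logLogRate β (1 / 2)) / (Fintype.card Arm : ℝ) with hd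
  have hd0 : 0 < d := div_pos (by linarith) hN
  set s := ∑ b ∈ Finset.univ.erase aStar, logLogRate β (p b) * p b ^ 2 / p aStar
  have hs : 0 ≤ s := Finset.sum_nonneg fun b _ =>
    div_nonneg (mul_nonneg (hα b).le (sq_nonneg _)) hx0.le
  have hterm : ∀ a ∈ Finset.univ.erase aStar,
      p a * r a * (K * (1 - (p aStar - logLogRate β (p a) * p a)) +
        1 / (p aStar - logLogRate β (p a) * p a) ^ 2 - (K * (1 - p aStar) + 1 / p aStar ^ 2)) ≤
      K * (logLogRate β (p a) * p a ^ 2 * r a) + 2 / d ^ 4 * (logLogRate β (p a) * p a ^ 2) := by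
    intro a ha
    have ha' := Finset.ne_of_mem_erase ha
    have h12 := hp.le_half hl ha'
    have hle := mem_leaders.1 hl a
    have hpa := hp.1 a
    have hα12 := logLogRate_mono hβ hpa h12 (by norm_num)
    have hαa := hα a
    have hra := hr a
    have hy : 0 ≤ logLogRate β (p a) * p a := by positivity
    have hdx : d ≤ p aStar - logLogRate β (p a) * p a := by
      have : d = 1 / (Fintype.card Arm : ℝ) * (1 - logLogRate β (1 / 2)) := by rw [hd]; ring
      rw [this]
      have : 1 / (Fintype.card Arm : ℝ) * (1 - logLogRate β (1 / 2)) ≤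
          p aStar * (1 - logLogRate β (1 / 2)) := by gcongr
      nlinarith
    have h1 := inv_sq_sub_le hd0 hdx hy hx1
    have h2 := mul_le_mul_of_nonneg_left h1 (mul_nonneg hpa.le hra.1)
    have h3 : p a * r a * (2 / d ^ 4 * (logLogRate β (p a) * p a)) ≤
        2 / d ^ 4 * (logLogRate β (p a) * p a ^ 2) := by
      have : 0 ≤ 2 / d ^ 4 * (logLogRate β (p a) * p a ^ 2) := by positivity
      calc _ = r a * (2 / d ^ 4 * (logLogRate β (p a) * p a ^ 2)) := by ring
        _ ≤ 1 * _ := by gcongr; exact hra.2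
        _ = _ := one_mul _
    linarith
  have hlead : p aStar * r aStar * (K * (1 - (p aStar + s)) + 1 / (p aStar + s) ^ 2 -
      (K * (1 - p aStar) + 1 / p aStar ^ 2)) ≤
      -∑ b ∈ Finset.univ.erase aStar, K * (logLogRate β (p b) * p b ^ 2 * r aStar) := by
    have h1 : 1 / (p aStar + s) ^ 2 ≤ 1 / p aStar ^ 2 := by gcongr; linarith
    have h2 : p aStar * r aStar * (K * s) =
        ∑ b ∈ Finset.univ.erase aStar, K * (logLogRate β (p b) * p b ^ 2 * r aStar) := by
      simp only [s, Finset.mul_sum]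
      exact Finset.sum_congr rfl fun b _ => by field_simp
    rw [← h2]
    nlinarith [mul_nonneg hx0.le (hr aStar).1]
  have h3 : ∀ b ∈ Finset.univ.erase aStar, β / 2 * p b ^ 3 ≤
      K * (logLogRate β (p b) * p b ^ 2 * r aStar) -
      (K * (logLogRate β (p b) * p b ^ 2 * r b) + 2 / d ^ 4 * (logLogRate β (p b) * p b ^ 2)) := by
    intro b hb
    have hgb := hg b (Finset.ne_of_mem_erase hb)
    have h4 := half_mul_le_logLogRate hβ (hp.1 b) (hp.le_one b)
    have hq : 0 ≤ logLogRate β (p b) * p b ^ 2 := mul_nonneg (hα b).le (sq_nonneg _)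
    have h5 : β / 2 * p b ^ 3 ≤ logLogRate β (p b) * p b ^ 2 := by
      nlinarith [sq_nonneg (p b)]
    have h6 : K * g ≤ K * (r aStar - r b) := by gcongr
    nlinarith
  have h4 := Finset.sum_le_sum h3
  rw [Finset.sum_sub_distrib, ← Finset.mul_sum] at h4
  have h5 := Finset.sum_le_sum hterm
  have h6 := pow_sum_div_card_le_sum_pow (s := Finset.univ.erase aStar) (f := p)
    (fun b _ => (hp.1 b).le) 2
  rw [hp.sum_erase] at h6
  have h7 : (1 - p aStar) ^ 3 / (Fintype.card Arm : ℝ) ^ 2 ≤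
      ∑ b ∈ Finset.univ.erase aStar, p b ^ 3 := by
    rcases (Finset.univ.erase aStar).eq_empty_or_nonempty with he | he
    · have := hp.sum_erase aStar
      rw [he, Finset.sum_empty] at this
      rw [he, ← this]
      simp
    · refine le_trans ?_ h6
      have : 0 < ((Finset.univ.erase aStar).card : ℝ) := by exact_mod_cast he.card_pos
      have : ((Finset.univ.erase aStar).card : ℝ) ≤ Fintype.card Arm := by
        exact_mod_cast Finset.card_le_univ _
      exact div_le_div_of_nonneg_left (pow_nonneg (by linarith) _) (by positivity) (by gcongr)
  have h8 : β / 2 / (Fintype.card Arm : ℝ) ^ 2 * (1 - p aStar) ^ 3 =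
      β / 2 * ((1 - p aStar) ^ 3 / (Fintype.card Arm : ℝ) ^ 2) := by ring
  have h9 : β / 2 * ((1 - p aStar) ^ 3 / (Fintype.card Arm : ℝ) ^ 2) ≤
      β / 2 * ∑ b ∈ Finset.univ.erase aStar, p b ^ 3 := by gcongr
  linarith

/-- A Lyapunov function of the probability of the optimal arm. -/
lemma exists_lyapunov (hr : ∀ a, r a ∈ Set.Icc (0 : ℝ) 1)
    (hg : ∀ a ≠ aStar, g ≤ r aStar - r a) (hg0 : 0 < g) (hβ : 0 < β) (hβ1 : β ≤ 1) :
    ∃ K c : ℝ, 0 ≤ K ∧ 0 < c ∧ ∀ p : Arm → ℝ, IsInterior p → ∀ l ∈ leaders p,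
      drift r (logLogRate β) p l (fun q => K * (1 - q aStar) + 1 / q aStar ^ 2) ≤
        -(c * (1 - p aStar) ^ 3) := by
  have hN : 0 < (Fintype.card Arm : ℝ) := by
    exact_mod_cast Fintype.card_pos_iff.2 ⟨aStar⟩
  obtain ⟨ε, hε, hε2, hεα⟩ := exists_logLogRate_le β (div_pos hg0 (by norm_num : (0 : ℝ) < 15))
  have hα121 := logLogRate_lt_one (p := 1 / 2) hβ1 (by norm_num) (by norm_num)
  set A := 1 / (ε * (1 - logLogRate β (1 / 2))) ^ 2 + 1
  set B := 2 / ((1 - logLogRate β (1 / 2)) / (Fintype.card Arm : ℝ)) ^ 4 + 1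
  have hA : 0 ≤ A := by positivity
  have hB : 0 ≤ B := by positivity
  -- The two entries are what the non-leading and the leading case require. In the former the fixed
  -- decrease is weakened using `(1 - x)³ ≤ 1`.
  set K := max (A / (g * (β * ε ^ 3 / 2))) (B / g)
  have hK0 : 0 ≤ K := (div_nonneg hB hg0.le).trans (le_max_right _ _)
  refine ⟨K, min (min 1 (g * (β / 2))) (β / 2 / Fintype.card Arm ^ 2), hK0,
    lt_min (lt_min one_pos (by positivity)) (by positivity), fun p hp l hl => ?_⟩
  have hx0 := hp.1 aStar
  have hx1 := hp.le_one aStar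
  have h3 : (1 - p aStar) ^ 3 ≤ 1 := pow_le_one₀ (by linarith) (by linarith)
  have h30 : 0 ≤ (1 - p aStar) ^ 3 := pow_nonneg (by linarith) _
  by_cases h : aStar = l
  · subst h
    refine (lyapunov_drift_self hr hg hβ hβ1 hK0
      ((div_le_iff₀ hg0).1 (le_max_right _ _)) hp hl).trans ?_
    have := min_le_right (min 1 (g * (β / 2))) (β / 2 / (Fintype.card Arm : ℝ) ^ 2)
    have := mul_le_mul_of_nonneg_right this h30
    linarith
  · refine (lyapunov_drift_of_ne hr hg hg0 hβ hβ1 hε (by linarith) (by linarith) hK0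
      ((div_le_iff₀ (by positivity)).1 (le_max_left _ _)) hp hl h).trans ?_
    have h4 := min_le_left (min 1 (g * (β / 2))) (β / 2 / (Fintype.card Arm : ℝ) ^ 2)
    have h5 := mul_le_mul_of_nonneg_right h4 h30
    have h6 : 0 ≤ min 1 (g * (β / 2)) := le_min zero_le_one (by positivity)
    nlinarith

/-! ### Drift of the potential against the regret -/

lemma neg_drift_le_truncPotential_drift (hr : ∀ a, r a ∈ Set.Icc (0 : ℝ) 1) (hβ : 0 < β)
    (hβ1 : β ≤ 1) {δ : ℝ} (hδ : 0 < δ) (hδ1 : δ ≤ 1) (hp : IsInterior p) (hl : l ∈ leaders p)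
    (a : Arm) :
    truncSlope β δ (p a) * -drift r (logLogRate β) p l (fun q => q a) ≤
      drift r (logLogRate β) p l (fun q => truncPotential β δ (q a)) := by
  unfold drift
  rw [← Finset.sum_neg_distrib, Finset.mul_sum]
  refine Finset.sum_le_sum fun b _ => ?_
  have h := truncPotential_tangent hβ hδ hδ1 (hp.le_one a)
    ((isInterior_move_logLogRate hβ hβ1 hp hl b).le_one a)
  have := mul_le_mul_of_nonneg_left h (mul_nonneg (hp.1 b).le (hr b).1)
  linarith

/-- The total truncated potential of the suboptimal arms grows at least as fast as the regret,
up to an error of `1` while the optimal arm has probability at most `1 / 2`. -/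
lemma regret_le_potential_drift (hr : ∀ a, r a ∈ Set.Icc (0 : ℝ) 1)
    (hStar : ∀ a ≠ aStar, r a < r aStar) (hβ : 0 < β)
    (hβ1 : β ≤ 1) {δ : ℝ} (hδ : 0 < δ) (hδ1 : δ ≤ 1) (hp : IsInterior p) (hl : l ∈ leaders p) :
    ∑ a, p a * (r aStar - r a) - (if p aStar ≤ 1 / 2 then 1 else 0) -
        ((Fintype.card Arm : ℝ) - 1) * (δ / 3) ≤
      drift r (logLogRate β) p l
        (fun q => ∑ a ∈ Finset.univ.erase aStar, truncPotential β δ (q a)) := by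
  have hcard : ((Finset.univ.erase aStar).card : ℝ) = (Fintype.card Arm : ℝ) - 1 := by
    rw [Finset.card_erase_of_mem (Finset.mem_univ _), Finset.card_univ,
      Nat.cast_sub (Fintype.card_pos_iff.2 ⟨aStar⟩), Nat.cast_one]
  have hsum : drift r (logLogRate β) p l
      (fun q => ∑ a ∈ Finset.univ.erase aStar, truncPotential β δ (q a)) =
      ∑ a ∈ Finset.univ.erase aStar,
        drift r (logLogRate β) p l (fun q => truncPotential β δ (q a)) := by
    unfold drift
    rw [Finset.sum_comm]
    refine Finset.sum_congr rfl fun b _ => ?_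
    rw [← Finset.sum_sub_distrib, Finset.mul_sum]
  rw [hsum]
  refine le_trans ?_ (Finset.sum_le_sum fun a _ =>
    neg_drift_le_truncPotential_drift hr hβ hβ1 hδ hδ1 hp hl a)
  have hind : (0 : ℝ) ≤ if p aStar ≤ 1 / 2 then 1 else 0 := by split_ifs <;> norm_num
  have hreg : ∑ a, p a * (r aStar - r a) =
      ∑ a ∈ Finset.univ.erase aStar, p a * (r aStar - r a) := by
    rw [← Finset.add_sum_erase _ _ (Finset.mem_univ aStar)]; simp
  by_cases h : l = aStar
  · subst h
    have : ∑ a ∈ Finset.univ.erase l, (p a * (r l - r a) - δ / 3) ≤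
        ∑ a ∈ Finset.univ.erase l,
          truncSlope β δ (p a) * -drift r (logLogRate β) p l (fun q => q a) := by
      refine Finset.sum_le_sum fun a ha => ?_
      have hne := Finset.ne_of_mem_erase ha
      rw [drift_eval_of_ne hp hne]
      have h1 := sub_le_truncSlope_mul hβ hδ hδ1 (hp.1 a) (hp.le_one a)
      have h2 := mul_le_mul_of_nonneg_right h1 (sub_nonneg.2 (hStar a hne).le)
      have h3 : δ / 3 * (r l - r a) ≤ δ / 3 * 1 := by
        gcongr; linarith [(hr l).2, (hr a).1]
      linarith
    rw [Finset.sum_sub_distrib, Finset.sum_const, nsmul_eq_mul, hcard] at this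
    linarith
  -- A suboptimal `l` leads. The drift of its own potential is split among the other arms: the share
  -- of the optimal arm has a favourable sign, and that of `a` is merged with the drift of the
  -- potential of `a`. Each suboptimal arm then falls short by at most its probability, hence by at
  -- most `1` in total.
  · have hle : p aStar ≤ 1 / 2 := hp.le_half hl (Ne.symm h)
    rw [if_pos hle]
    have hl' : l ∈ Finset.univ.erase aStar := Finset.mem_erase.2 ⟨h, Finset.mem_univ _⟩
    have hs' : aStar ∈ Finset.univ.erase l := Finset.mem_erase.2 ⟨Ne.symm h, Finset.mem_univ _⟩
    have hS : (Finset.univ.erase l).erase aStar = (Finset.univ.erase aStar).erase l :=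
      Finset.erase_right_comm
    rw [hreg, ← Finset.add_sum_erase _ _ hl', ← Finset.add_sum_erase _ _ hl',
      drift_eval_self hp, ← Finset.add_sum_erase _ _ hs', hS]
    set S := (Finset.univ.erase aStar).erase l with hSdef
    have hφl := truncSlope_pos hβ hδ hδ1 (hp.le_one l)
    have hα := fun b => logLogRate_pos hβ (hp.1 b) (hp.le_one b)
    have hpoint : ∀ a ∈ S, p a * (r aStar - r a) - p a ≤
        truncSlope β δ (p a) * -drift r (logLogRate β) p l (fun q => q a) -
          truncSlope β δ (p l) * (logLogRate β (p a) * p a ^ 2 * (r l - r a)) := by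
      intro a ha
      have hal : a ≠ l := Finset.ne_of_mem_erase ha
      have has : a ≠ aStar := Finset.ne_of_mem_erase (Finset.mem_of_mem_erase ha)
      rw [drift_eval_of_ne hp hal]
      have hpa := hp.1 a
      have h1 : truncSlope β δ (p l) ≤ truncSlope β δ (p a) :=
        truncSlope_antitoneOn hβ hδ hδ1 (hp.le_one a) (hp.le_one l) (mem_leaders.1 hl a)
      have h2 : truncSlope β δ (p a) * (logLogRate β (p a) * p a) ≤ 1 := by
        have hmax : max (p a) δ ≤ 1 := max_le (hp.le_one a) hδ1
        have hm := logLogRate_mono hβ hpa (le_max_left (p a) δ) hmax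
        have hpos : 0 < max (p a) δ := lt_max_of_lt_right hδ
        rw [truncSlope, one_div_mul_eq_div, div_le_one (mul_pos ((hα a).trans_le hm) hpos)]
        exact mul_le_mul hm (le_max_left _ _) hpa.le ((hα a).le.trans hm)
      -- This coefficient lies in `[0, 1]`: the slope is antitone and `p a ≤ p l`, and truncation
      -- can only lower the slope below `1 / (α(p) p)`.
      set c := (truncSlope β δ (p a) - truncSlope β δ (p l)) * (logLogRate β (p a) * p a)
      have hc0 : 0 ≤ c := mul_nonneg (sub_nonneg.2 h1) (mul_nonneg (hα a).le hpa.le)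
      have hc1 : c ≤ 1 := by
        have : 0 ≤ truncSlope β δ (p l) * (logLogRate β (p a) * p a) :=
          mul_nonneg hφl.le (mul_nonneg (hα a).le hpa.le)
        simp only [c]; linarith
      have h3 : r aStar - r a - 1 ≤ c * (r l - r a) := by
        have := (hr aStar).2
        have := (hr a).1
        have := (hr l).1
        rcases le_total (r a) (r l) with h4 | h4 <;> nlinarith
      have := mul_le_mul_of_nonneg_left h3 hpa.le
      simp only [c] at this
      linarith
    have h1 := Finset.sum_le_sum hpoint
    rw [Finset.sum_sub_distrib, Finset.sum_sub_distrib, ← Finset.mul_sum] at h1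
    have h2 : ∑ a ∈ S, p a = 1 - p aStar - p l := by
      rw [← hp.sum_erase aStar, ← Finset.add_sum_erase _ _ hl']; ring
    have h3 : 0 ≤ truncSlope β δ (p l) *
        (logLogRate β (p aStar) * p aStar ^ 2 * (r aStar - r l)) :=
      mul_nonneg hφl.le (mul_nonneg (mul_nonneg (hα _).le (sq_nonneg _))
        (sub_nonneg.2 (hStar l h).le))
    have h4 : p l * (r aStar - r l) ≤ p l * 1 := by
      gcongr
      · exact (hp.1 l).le
      · linarith [(hr aStar).2, (hr l).1]
    have h5 : 0 ≤ ((Fintype.card Arm : ℝ) - 1) * (δ / 3) := by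
      rw [← hcard]; positivity
    have h6 := hp.1 aStar
    linarith

end Drift

/-! ### The gap -/

section Gap

variable {Arm : Type*} [Fintype Arm] {r : Arm → ℝ} {aStar : Arm}

lemma bestMean_eq (hStar : ∀ a, a ≠ aStar → r a < r aStar) : bestMean r = r aStar := by
  have : Nonempty Arm := ⟨aStar⟩
  refine le_antisymm (ciSup_le fun a => ?_) (le_ciSup (Set.finite_range r).bddAbove aStar)
  by_cases h : a = aStar
  · rw [h]
  · exact (hStar a h).le

lemma gap_le (hStar : ∀ a, a ≠ aStar → r a < r aStar) {a : Arm} (ha : a ≠ aStar) :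
    gap r aStar ≤ r aStar - r a := by
  have := le_ciSup (f := fun b : {a : Arm // a ≠ aStar} => r b) (Set.finite_range _).bddAbove ⟨a, ha⟩
  rw [gap, bestMean_eq hStar]
  linarith

lemma gap_pos [Nontrivial Arm] (hStar : ∀ a, a ≠ aStar → r a < r aStar) : 0 < gap r aStar := by
  obtain ⟨b, hb⟩ := exists_ne aStar
  have : Nonempty {a : Arm // a ≠ aStar} := ⟨⟨b, hb⟩⟩
  obtain ⟨c, hc⟩ := exists_eq_ciSup_of_finite (f := fun b : {a : Arm // a ≠ aStar} => r b)
  rw [gap, bestMean_eq hStar, ← hc]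
  exact sub_pos.2 (hStar c c.2)

end Gap

/-! ### Measurability and conditional laws along a run -/

/-- At each time only finitely many probability vectors can occur, so arbitrary functions of them
are measurable and integrable. -/
lemma measurable_comp_of_finite_range {Ω S T : Type*} {m : MeasurableSpace Ω} [MeasurableSpace S]
    [MeasurableSingletonClass S] [MeasurableSpace T] {X : Ω → S} (hX : Measurable X)
    (hfin : (Set.range X).Finite) (f : S → T) : Measurable fun ω => f (X ω) := by
  intro B _
  have : (fun ω => f (X ω)) ⁻¹' B = X ⁻¹' (f ⁻¹' B ∩ Set.range X) := by
    ext ω; simp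
  rw [this]
  exact hX (hfin.inter_of_right _).measurableSet

lemma integrable_of_finite_range {Ω : Type*} [MeasurableSpace Ω] {P : Measure Ω}
    [IsFiniteMeasure P] {f : Ω → ℝ} (hf : Measurable f) (hfin : (Set.range f).Finite) :
    Integrable f P :=
  (SimpleFunc.mk f (fun x => hf (measurableSet_singleton x)) hfin).integrable_of_isFiniteMeasure

lemma finite_range_comp {Ω S T : Type*} {X : Ω → S} (hfin : (Set.range X).Finite) (f : S → T) :
    (Set.range fun ω => f (X ω)).Finite := by
  rw [show (fun ω => f (X ω)) = f ∘ X from rfl, Set.range_comp]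
  exact hfin.image f

section Run

variable {Arm Ω : Type*} [Fintype Arm] [DecidableEq Arm]
  [MeasurableSpace Arm] [MeasurableSingletonClass Arm] [MeasurableSpace Ω] {P : Measure Ω}
  {r : Arm → ℝ} {α : ℝ → ℝ} {p₀ : Arm → ℝ} {A L : ℕ → Ω → Arm} {R : ℕ → Ω → Arm → Bool}

omit [MeasurableSpace Arm] [MeasurableSingletonClass Arm] [MeasurableSpace Ω] in
lemma finite_range_prob (t : ℕ) : (Set.range (prob α p₀ A L R t)).Finite := by
  induction t with
  | zero => exact (Set.finite_singleton p₀).subset (by rintro _ ⟨ω, rfl⟩; rfl)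
  | succ t ih =>
    refine ((ih.prod (Set.finite_univ (α := Arm × Arm × (Arm → Bool)))).image
      fun x => step α x.1 x.2.1 x.2.2.1 x.2.2.2).subset ?_
    rintro _ ⟨ω, rfl⟩
    exact ⟨(prob α p₀ A L R t ω, A t ω, L t ω, R t ω), ⟨⟨ω, rfl⟩, trivial⟩, rfl⟩

omit [MeasurableSpace Arm] [MeasurableSingletonClass Arm] [MeasurableSpace Ω] in
lemma finite_range_prob_outcome (t : ℕ) :
    (Set.range fun ω => (prob α p₀ A L R t ω, A t ω, L t ω, R t ω)).Finite := by
  refine ((finite_range_prob (α := α) (p₀ := p₀) (A := A) (L := L) (R := R) t).prod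
      (Set.finite_univ (α := Arm × Arm × (Arm → Bool)))).subset ?_
  rintro _ ⟨ω, rfl⟩
  exact ⟨⟨ω, rfl⟩, trivial⟩

omit [DecidableEq Arm] [MeasurableSingletonClass Arm] [Fintype Arm] [MeasurableSpace Ω] in
lemma measurable_outcome_history {s t : ℕ} (h : s < t) :
    Measurable[history A L R t] fun ω => (A s ω, L s ω, R s ω) :=
  Measurable.of_comap_le (le_iSup₂_of_le s h le_rfl)

omit [DecidableEq Arm] [MeasurableSingletonClass Arm] [Fintype Arm] [MeasurableSpace Ω] in
lemma history_mono {s t : ℕ} (h : s ≤ t) : history A L R s ≤ history A L R t :=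
  iSup₂_le fun u hu => le_iSup₂_of_le u (hu.trans_le h) le_rfl

omit [MeasurableSpace Ω] in
lemma measurable_prob_history (t : ℕ) :
    Measurable[history A L R t] (prob α p₀ A L R t) := by
  induction t with
  | zero => exact measurable_const
  | succ t ih =>
    have h1 : Measurable[history A L R (t + 1)]
        fun ω => (prob α p₀ A L R t ω, A t ω, L t ω, R t ω) :=
      (ih.mono (history_mono t.le_succ) le_rfl).prodMk (measurable_outcome_history t.lt_succ_self)
    exact measurable_comp_of_finite_range h1 (finite_range_prob_outcome t)
      fun x => step α x.1 x.2.1 x.2.2.1 x.2.2.2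

namespace IsRun

variable (h : IsRun P r α p₀ A L R)
include h

omit [MeasurableSingletonClass Arm] in
lemma measurable_outcome (t : ℕ) : Measurable fun ω => (A t ω, L t ω, R t ω) :=
  (h.measurable_A t).prodMk ((h.measurable_L t).prodMk (h.measurable_R t))

omit [MeasurableSingletonClass Arm] in
lemma history_le (t : ℕ) : history A L R t ≤ ‹MeasurableSpace Ω› :=
  iSup₂_le fun s _ => (h.measurable_outcome s).comap_le

lemma measurable_prob (t : ℕ) : Measurable (prob α p₀ A L R t) :=
  (measurable_prob_history t).mono (h.history_le t) le_rfl

lemma integrable_comp [IsFiniteMeasure P] (t : ℕ) (f : (Arm → ℝ) → ℝ) :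
    Integrable (fun ω => f (prob α p₀ A L R t ω)) P :=
  integrable_of_finite_range
    (measurable_comp_of_finite_range (h.measurable_prob t) (finite_range_prob t) f)
    (finite_range_comp (finite_range_prob t) f)

lemma measurable_pair (t : ℕ) :
    Measurable fun ω => (prob α p₀ A L R t ω, A t ω, L t ω, R t ω) :=
  (h.measurable_prob t).prodMk (h.measurable_outcome t)

lemma integrable_pair [IsFiniteMeasure P] (t : ℕ)
    (g : (Arm → ℝ) → Arm × Arm × (Arm → Bool) → ℝ) :
    Integrable (fun ω => g (prob α p₀ A L R t ω) (A t ω, L t ω, R t ω)) P :=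
  integrable_of_finite_range
    (measurable_comp_of_finite_range (h.measurable_pair t) (finite_range_prob_outcome t)
      fun x => g x.1 x.2)
    (finite_range_comp (finite_range_prob_outcome t) fun x => g x.1 x.2)

/-- The conditional mean of a function of the current probability vector and of the outcome. -/
lemma condExp_outcome [IsFiniteMeasure P] (t : ℕ)
    (g : (Arm → ℝ) → Arm × Arm × (Arm → Bool) → ℝ) :
    P[fun ω => g (prob α p₀ A L R t ω) (A t ω, L t ω, R t ω) | history A L R t] =ᵐ[P]
      fun ω => ∑ o, outcomeWeight r (prob α p₀ A L R t ω) o * g (prob α p₀ A L R t ω) o := by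
  let I : Arm × Arm × (Arm → Bool) → Ω → ℝ := fun o =>
    Set.indicator {ω | A t ω = o.1 ∧ L t ω = o.2.1 ∧ R t ω = o.2.2} fun _ => 1
  let G : Arm × Arm × (Arm → Bool) → Ω → ℝ := fun o ω => g (prob α p₀ A L R t ω) o
  have hI : ∀ o ω, I o ω = if (A t ω, L t ω, R t ω) = o then 1 else 0 := by
    intro o ω
    simp only [I, Set.indicator, Set.mem_ofPred_eq, Prod.ext_iff]
    congr
  -- Splitting over outcomes: the factor `G o` is known at time `t` and can be pulled out, while the
  -- conditional mean of the indicator `I o` is given by `law`.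
  have e : (fun ω => g (prob α p₀ A L R t ω) (A t ω, L t ω, R t ω)) = ∑ o, I o * G o := by
    funext ω
    simp [hI, G]
  have hint : ∀ o, Integrable (I o * G o) P := by
    intro o
    have := h.integrable_pair t fun p o' => (if o' = o then 1 else 0) * g p o
    refine this.congr (Eventually.of_forall fun ω => ?_)
    simp [hI, G]
  have hint' : ∀ o, Integrable (I o) P := by
    intro o
    have := h.integrable_pair t fun _ o' => if o' = o then 1 else 0
    refine this.congr (Eventually.of_forall fun ω => ?_)
    simp [hI]
  have hG : ∀ o, StronglyMeasurable[history A L R t] (G o) := fun o =>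
    (measurable_comp_of_finite_range (measurable_prob_history t) (finite_range_prob t)
      fun p => g p o).stronglyMeasurable
  have hterm : ∀ o, P[I o * G o | history A L R t] =ᵐ[P]
      fun ω => outcomeWeight r (prob α p₀ A L R t ω) o * g (prob α p₀ A L R t ω) o := by
    intro o
    filter_upwards [condExp_mul_of_stronglyMeasurable_right (hG o) (hint o) (hint' o),
      h.law t o.1 o.2.1 o.2.2] with ω h1 h2
    rw [h1, Pi.mul_apply]
    congr 1
  rw [e]
  filter_upwards [condExp_finsetSum (fun o (_ : o ∈ Finset.univ) => hint o) (history A L R t),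
    ae_all_iff.2 hterm] with ω h1 h2
  rw [h1, Finset.sum_apply]
  exact Finset.sum_congr rfl fun o _ => h2 o

lemma integral_outcome [IsFiniteMeasure P] (t : ℕ)
    (g : (Arm → ℝ) → Arm × Arm × (Arm → Bool) → ℝ) :
    ∫ ω, g (prob α p₀ A L R t ω) (A t ω, L t ω, R t ω) ∂P =
      ∫ ω, ∑ o, outcomeWeight r (prob α p₀ A L R t ω) o * g (prob α p₀ A L R t ω) o ∂P := by
  rw [← integral_condExp (h.history_le t)]
  exact integral_congr_ae (h.condExp_outcome t g)

lemma integral_prob_succ [IsFiniteMeasure P] (t : ℕ) (f : (Arm → ℝ) → ℝ) :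
    ∫ ω, f (prob α p₀ A L R (t + 1) ω) ∂P = ∫ ω, stepMean r α (prob α p₀ A L R t ω) f ∂P :=
  h.integral_outcome t fun p o => f (step α p o.1 o.2.1 o.2.2)

lemma ae_mem_leaders [IsFiniteMeasure P] (t : ℕ) :
    ∀ᵐ ω ∂P, L t ω ∈ leaders (prob α p₀ A L R t ω) := by
  have h1 := h.integral_outcome t fun p o => if o.2.1 ∈ leaders p then 0 else 1
  have h2 : ∀ p (o : Arm × Arm × (Arm → Bool)),
      outcomeWeight r p o * (if o.2.1 ∈ leaders p then 0 else 1) = 0 := by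
    intro p o
    by_cases ho : o.2.1 ∈ leaders p <;> simp [outcomeWeight, ho]
  simp only [h2, Finset.sum_const_zero, integral_zero] at h1
  rw [integral_eq_zero_iff_of_nonneg (fun ω => by dsimp only [Pi.zero_apply]; split_ifs <;> norm_num)
    (h.integrable_pair t fun p o => if o.2.1 ∈ leaders p then 0 else 1)] at h1
  filter_upwards [h1] with ω hω
  by_contra hc
  simp [hc] at hω

end IsRun

end Run

/-! ### The transition kernel -/

section Kernel

variable {Arm : Type*} [Fintype Arm] [DecidableEq Arm] {α : ℝ → ℝ} {r : Arm → ℝ}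

lemma measurable_step (hα : Measurable α) (a l : Arm) (ρ : Arm → Bool) :
    Measurable fun p => step α p a l ρ := by
  have h1 : ∀ b, Measurable fun p => armUpdate α p a l ρ b := by
    intro b
    unfold armUpdate
    have : Measurable fun p : Arm → ℝ => α (p b) := hα.comp (measurable_pi_apply b)
    fun_prop
  refine measurable_pi_lambda _ fun b => ?_
  unfold step
  split_ifs
  · fun_prop
  · exact h1 b

omit [DecidableEq Arm] in
lemma measurableSet_leaders_eq (s : Finset Arm) :
    MeasurableSet {p : Arm → ℝ | leaders p = s} := by
  have : {p : Arm → ℝ | leaders p = s} = ⋂ l, {p | (∀ b, p b ≤ p l) ↔ l ∈ s} := by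
    ext p
    simp [Finset.ext_iff, mem_leaders]
  rw [this]
  refine MeasurableSet.iInter fun l => ?_
  have h : MeasurableSet {p : Arm → ℝ | ∀ b, p b ≤ p l} := by
    rw [Set.ofPred_forall]
    exact MeasurableSet.iInter fun b =>
      measurableSet_le (measurable_pi_apply b) (measurable_pi_apply l)
  by_cases hl : l ∈ s
  · simpa [hl] using h
  · refine h.compl.congr ?_
    ext p
    simp [hl]

lemma measurable_outcomeWeight (o : Arm × Arm × (Arm → Bool)) :
    Measurable fun p : Arm → ℝ => outcomeWeight r p o := by
  have h : ∀ f : Finset Arm → ℝ, Measurable fun p : Arm → ℝ => f (leaders p) := by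
    intro f
    let _ : MeasurableSpace (Finset Arm) := ⊤
    exact (measurable_from_top (f := f)).comp (measurable_to_countable' measurableSet_leaders_eq)
  unfold outcomeWeight
  exact ((measurable_pi_apply _).mul
    (h fun s => if o.2.1 ∈ s then 1 / (s.card : ℝ) else 0)).mul_const _

omit [DecidableEq Arm] in
lemma measurableSet_isInterior : MeasurableSet {p : Arm → ℝ | IsInterior p} := by
  unfold IsInterior
  rw [Set.ofPred_and, Set.ofPred_forall]
  refine (MeasurableSet.iInter fun b =>
    measurableSet_lt measurable_const (measurable_pi_apply b)).inter ?_
  exact measurableSet_eq_fun (by fun_prop) measurable_const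

/-- The one-step transition law of the probability vector; outside the probability vectors with
positive entries, where it plays no role, the chain stays put. -/
noncomputable def transition (r : Arm → ℝ) (α : ℝ → ℝ) (p : Arm → ℝ) : Measure (Arm → ℝ) :=
  open Classical in
  if IsInterior p then
    ∑ o : Arm × Arm × (Arm → Bool),
      ENNReal.ofReal (outcomeWeight r p o) • Measure.dirac (step α p o.1 o.2.1 o.2.2)
  else Measure.dirac p

lemma measurable_transition (hα : Measurable α) : Measurable (transition r α) := by
  refine Measurable.ite measurableSet_isInterior ?_ Measure.measurable_dirac
  refine Measure.measurable_of_measurable_coe _ fun B hB => ?_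
  simp only [Measure.coe_finsetSum, Finset.sum_apply, Measure.smul_apply, smul_eq_mul]
  refine Finset.measurable_sum _ fun o _ => ?_
  refine (measurable_outcomeWeight o).ennreal_ofReal.mul ?_
  exact (Measure.measurable_coe hB).comp
    (Measure.measurable_dirac.comp (measurable_step hα _ _ _))

lemma transition_real (hr : ∀ a, r a ∈ Set.Icc (0 : ℝ) 1) {p : Arm → ℝ} (hp : IsInterior p)
    {B : Set (Arm → ℝ)} (hB : MeasurableSet B) :
    (transition r α p).real B = stepMean r α p (B.indicator fun _ => 1) := by
  rw [transition, if_pos hp, Measure.real, Measure.coe_finsetSum, Finset.sum_apply,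
    ENNReal.toReal_sum]
  · refine Finset.sum_congr rfl fun o _ => ?_
    rw [Measure.smul_apply, smul_eq_mul, ENNReal.toReal_mul,
      ENNReal.toReal_ofReal (outcomeWeight_nonneg hr (fun a => (hp.1 a).le) o),
      Measure.dirac_apply' _ hB]
    by_cases h : step α p o.1 o.2.1 o.2.2 ∈ B <;> simp [h]
  · intro o _
    rw [Measure.smul_apply, smul_eq_mul]
    exact ENNReal.mul_ne_top ENNReal.ofReal_ne_top (measure_ne_top _ _)

lemma isProbabilityMeasure_transition [Nonempty Arm] (hr : ∀ a, r a ∈ Set.Icc (0 : ℝ) 1)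
    (p : Arm → ℝ) : IsProbabilityMeasure (transition r α p) := by
  by_cases hp : IsInterior p
  · have h1 := transition_real (α := α) hr hp MeasurableSet.univ
    have h2 : stepMean r α p (Set.univ.indicator fun _ => 1) = 1 := by
      simpa [stepMean] using sum_outcomeWeight (r := r) hp
    rw [h2] at h1
    refine ⟨?_⟩
    rwa [Measure.real, ENNReal.toReal_eq_one_iff] at h1
  · rw [transition, if_neg hp]
    infer_instance

end Kernel

/-! ### Markov property, convergence and regret -/

/-- The tower property. It carries the transition law from the full history to the coarser
filtration of the probability vectors, as this law depends on the current vector only. -/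
lemma condExp_ae_eq_of_le {Ω : Type*} {m₁ m₂ m₀ : MeasurableSpace Ω} {P : Measure Ω}
    [IsFiniteMeasure P] {f g : Ω → ℝ} (h₁ : m₁ ≤ m₂) (h₂ : m₂ ≤ m₀) (hfg : P[f | m₂] =ᵐ[P] g)
    (hg : StronglyMeasurable[m₁] g) (hgi : Integrable g P) : P[f | m₁] =ᵐ[P] g := by
  have h := condExp_of_stronglyMeasurable (h₁.trans h₂) hg hgi
  exact (condExp_condExp_of_le h₁ h₂).symm.trans
    ((condExp_congr_ae hfg).trans (Eventually.of_forall fun ω => congrFun h ω))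

section Run

variable {Arm Ω : Type*} [Fintype Arm] [DecidableEq Arm]
  [MeasurableSpace Arm] [MeasurableSingletonClass Arm] [MeasurableSpace Ω] {P : Measure Ω}
  [IsProbabilityMeasure P] {r : Arm → ℝ} {β : ℝ} {p₀ : Arm → ℝ} {A L : ℕ → Ω → Arm}
  {R : ℕ → Ω → Arm → Bool} {aStar : Arm}

namespace IsRun

lemma ae_isInterior (h : IsRun P r (logLogRate β) p₀ A L R) (hβ : 0 < β) (hβ1 : β ≤ 1)
    (hp₀ : IsInterior p₀) (t : ℕ) : ∀ᵐ ω ∂P, IsInterior (prob (logLogRate β) p₀ A L R t ω) := by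
  induction t with
  | zero => exact Eventually.of_forall fun _ => hp₀
  | succ t ih =>
    filter_upwards [ih, h.ae_mem_leaders t] with ω h1 h2
    exact isInterior_step hβ hβ1 h1 h2 _ _

theorem isMarkovChain [Nonempty Arm] (h : IsRun P r (logLogRate β) p₀ A L R)
    (hr : ∀ a, r a ∈ Set.Icc (0 : ℝ) 1) (hβ : 0 < β) (hβ1 : β ≤ 1) (hp₀ : IsInterior p₀) :
    IsMarkovChain P (prob (logLogRate β) p₀ A L R) := by
  refine ⟨h.measurable_prob, ⟨transition r (logLogRate β),
    measurable_transition (measurable_logLogRate β)⟩,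
    ⟨fun p => isProbabilityMeasure_transition hr p⟩, fun t B hB => ?_⟩
  have hle : (⨆ (s : ℕ) (_ : s ≤ t), MeasurableSpace.comap (prob (logLogRate β) p₀ A L R s)
      inferInstance) ≤ history A L R t := iSup₂_le fun s hs =>
    ((measurable_prob_history s).mono (history_mono hs) le_rfl).comap_le
  have hmeas : Measurable[⨆ (s : ℕ) (_ : s ≤ t), MeasurableSpace.comap
      (prob (logLogRate β) p₀ A L R s) inferInstance] (prob (logLogRate β) p₀ A L R t) :=
    Measurable.of_comap_le (le_iSup₂_of_le t le_rfl le_rfl)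
  refine condExp_ae_eq_of_le hle (h.history_le t) ?_
    (measurable_comp_of_finite_range hmeas (finite_range_prob t)
      fun p => (transition r (logLogRate β) p).real B).stronglyMeasurable
    (h.integrable_comp t fun p => (transition r (logLogRate β) p).real B)
  filter_upwards [h.condExp_outcome t fun p o =>
    B.indicator (fun _ => 1) (step (logLogRate β) p o.1 o.2.1 o.2.2),
    h.ae_isInterior hβ hβ1 hp₀ t] with ω h2 h3
  exact h2.trans (transition_real hr h3 hB).symm

/-- The third moments of `1 - p_{a^⋆}(t)` are summable. -/
theorem summable_integral_cube [Nontrivial Arm] (h : IsRun P r (logLogRate β) p₀ A L R)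
    (hr : ∀ a, r a ∈ Set.Icc (0 : ℝ) 1) (hStar : ∀ a, a ≠ aStar → r a < r aStar)
    (hβ : 0 < β) (hβ1 : β ≤ 1) (hp₀ : IsInterior p₀) :
    Summable fun t => ∫ ω, (1 - prob (logLogRate β) p₀ A L R t ω aStar) ^ 3 ∂P := by
  obtain ⟨K, c, hK, hc, hdrift⟩ := exists_lyapunov (aStar := aStar) hr
    (fun a ha => gap_le hStar ha) (gap_pos hStar) hβ hβ1
  set V : (Arm → ℝ) → ℝ := fun q => K * (1 - q aStar) + 1 / q aStar ^ 2
  set X := prob (logLogRate β) p₀ A L R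
  have hnn : ∀ t, 0 ≤ ∫ ω, (1 - X t ω aStar) ^ 3 ∂P := fun t => by
    refine integral_nonneg_of_ae ?_
    filter_upwards [h.ae_isInterior hβ hβ1 hp₀ t] with ω hω
    exact pow_nonneg (sub_nonneg.2 (hω.le_one aStar)) 3
  have hV : ∀ t, 0 ≤ ∫ ω, V (X t ω) ∂P := fun t => by
    refine integral_nonneg_of_ae ?_
    filter_upwards [h.ae_isInterior hβ hβ1 hp₀ t] with ω hω
    have := hω.le_one aStar
    have h1 : 0 ≤ K * (1 - X t ω aStar) := mul_nonneg hK (by linarith)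
    exact add_nonneg h1 (by positivity)
  have hstep : ∀ t, ∫ ω, V (X (t + 1) ω) ∂P ≤
      ∫ ω, V (X t ω) ∂P - c * ∫ ω, (1 - X t ω aStar) ^ 3 ∂P := by
    intro t
    have hi1 := h.integrable_comp t V
    have hi2 := h.integrable_comp t fun q => c * (1 - q aStar) ^ 3
    rw [h.integral_prob_succ t V, ← integral_const_mul, ← integral_sub hi1 hi2]
    refine integral_mono_ae (h.integrable_comp t fun p => stepMean r (logLogRate β) p V)
      (hi1.sub hi2) ?_
    filter_upwards [h.ae_isInterior hβ hβ1 hp₀ t] with ω hω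
    have := stepMean_le hω (hdrift _ hω)
    simpa [sub_eq_add_neg] using this
  have hsum : ∀ T, c * ∑ t ∈ Finset.range T, ∫ ω, (1 - X t ω aStar) ^ 3 ∂P ≤
      ∫ ω, V (X 0 ω) ∂P - ∫ ω, V (X T ω) ∂P := by
    intro T
    induction T with
    | zero => simp
    | succ T ih =>
      rw [Finset.sum_range_succ]
      linarith [hstep T]
  refine summable_of_sum_range_le (c := (∫ ω, V (X 0 ω) ∂P) / c) hnn fun T => ?_
  rw [le_div_iff₀ hc]
  linarith [hsum T, hV T]

theorem summable_measureReal_le_half [Nontrivial Arm] (h : IsRun P r (logLogRate β) p₀ A L R)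
    (hr : ∀ a, r a ∈ Set.Icc (0 : ℝ) 1) (hStar : ∀ a, a ≠ aStar → r a < r aStar)
    (hβ : 0 < β) (hβ1 : β ≤ 1) (hp₀ : IsInterior p₀) :
    Summable fun t => P.real {ω | prob (logLogRate β) p₀ A L R t ω aStar ≤ 1 / 2} := by
  -- Markov's inequality: where `x ≤ 1/2`, `8 (1 - x)³ ≥ 1`.
  refine Summable.of_nonneg_of_le (fun t => measureReal_nonneg) (fun t => ?_)
    ((h.summable_integral_cube hr hStar hβ hβ1 hp₀).mul_left 8)
  have hX : Measurable fun ω => prob (logLogRate β) p₀ A L R t ω aStar :=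
    (measurable_pi_apply aStar).comp (h.measurable_prob t)
  have hm : MeasurableSet {ω | prob (logLogRate β) p₀ A L R t ω aStar ≤ 1 / 2} :=
    measurableSet_le hX measurable_const
  rw [← integral_indicator_one hm, ← integral_const_mul]
  refine integral_mono_ae ((integrable_const (1 : ℝ)).indicator hm)
    (h.integrable_comp t fun q => 8 * (1 - q aStar) ^ 3) ?_
  filter_upwards [h.ae_isInterior hβ hβ1 hp₀ t] with ω hω
  have := hω.le_one aStar
  have h3 : 0 ≤ (1 - prob (logLogRate β) p₀ A L R t ω aStar) ^ 3 := pow_nonneg (by linarith) 3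
  by_cases hle : prob (logLogRate β) p₀ A L R t ω aStar ≤ 1 / 2
  · have : (1 / 2 : ℝ) ^ 3 ≤ (1 - prob (logLogRate β) p₀ A L R t ω aStar) ^ 3 := by
      gcongr; linarith
    rw [Set.indicator_of_mem (by exact hle), Pi.one_apply]
    linarith
  · rw [Set.indicator_of_notMem (by exact hle)]
    linarith

/-- By Tonelli, the series of the `(1 - x)³` has finite mean, so it converges almost surely and its
terms tend to `0`. -/
theorem ae_tendsto_one [Nontrivial Arm] (h : IsRun P r (logLogRate β) p₀ A L R)
    (hr : ∀ a, r a ∈ Set.Icc (0 : ℝ) 1) (hStar : ∀ a, a ≠ aStar → r a < r aStar)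
    (hβ : 0 < β) (hβ1 : β ≤ 1) (hp₀ : IsInterior p₀) :
    ∀ᵐ ω ∂P, Tendsto (fun t => prob (logLogRate β) p₀ A L R t ω aStar) atTop (𝓝 1) := by
  set X := prob (logLogRate β) p₀ A L R
  have hs := h.summable_integral_cube hr hStar hβ hβ1 hp₀
  have hmeas : ∀ t, Measurable fun ω => ENNReal.ofReal ((1 - X t ω aStar) ^ 3) := fun t =>
    measurable_comp_of_finite_range (h.measurable_prob t) (finite_range_prob t)
      fun q => ENNReal.ofReal ((1 - q aStar) ^ 3)
  have hlint : ∀ t, ∫⁻ ω, ENNReal.ofReal ((1 - X t ω aStar) ^ 3) ∂P =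
      ENNReal.ofReal (∫ ω, (1 - X t ω aStar) ^ 3 ∂P) := by
    intro t
    rw [ofReal_integral_eq_lintegral_ofReal (h.integrable_comp t fun q => (1 - q aStar) ^ 3)]
    filter_upwards [h.ae_isInterior hβ hβ1 hp₀ t] with ω hω
    exact pow_nonneg (sub_nonneg.2 (hω.le_one aStar)) 3
  have htop : ∫⁻ ω, ∑' t, ENNReal.ofReal ((1 - X t ω aStar) ^ 3) ∂P ≠ ⊤ := by
    rw [lintegral_tsum fun t => (hmeas t).aemeasurable]
    simp only [hlint]
    exact hs.tsum_ofReal_ne_top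
  filter_upwards [ae_lt_top (Measurable.tsum hmeas) htop,
    ae_all_iff.2 fun t => h.ae_isInterior hβ hβ1 hp₀ t] with ω h1 h2
  have h3 := ENNReal.tendsto_atTop_zero_of_tsum_ne_top h1.ne
  have h4 : Tendsto (fun t => (1 - X t ω aStar) ^ 3) atTop (𝓝 0) := by
    have := (ENNReal.tendsto_toReal ENNReal.zero_ne_top).comp h3
    refine this.congr fun t => ?_
    exact ENNReal.toReal_ofReal (pow_nonneg (sub_nonneg.2 ((h2 t).le_one aStar)) 3)
  have h5 : Tendsto (fun t => 1 - X t ω aStar) atTop (𝓝 0) := by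
    have := h4.rpow_const (p := 1 / 3) (Or.inr (by norm_num))
    rw [Real.zero_rpow (by norm_num)] at this
    refine this.congr fun t => ?_
    rw [← Real.rpow_natCast, ← Real.rpow_mul (sub_nonneg.2 ((h2 t).le_one aStar))]
    norm_num [X]
  simpa using h5.const_sub 1

lemma integral_reward (h : IsRun P r (logLogRate β) p₀ A L R) (hβ : 0 < β) (hβ1 : β ≤ 1)
    (hp₀ : IsInterior p₀) (t : ℕ) :
    ∫ ω, ∑ a, playInd (A t ω) a * rewardVal (R t ω a) ∂P =
      ∫ ω, ∑ a, prob (logLogRate β) p₀ A L R t ω a * r a ∂P := by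
  have : Nonempty Arm := by
    by_contra hc
    rw [not_nonempty_iff] at hc
    simpa using hp₀.2
  rw [h.integral_outcome t fun _ o => ∑ a, playInd o.1 a * rewardVal (o.2.2 a)]
  refine integral_congr_ae ?_
  filter_upwards [h.ae_isInterior hβ hβ1 hp₀ t] with ω hp
  set p := prob (logLogRate β) p₀ A L R t ω
  have hc : ((leaders p).card : ℝ) ≠ 0 := by
    simpa using (leaders_nonempty p).ne_empty
  have h0 : ∀ o : Arm × Arm × (Arm → Bool),
      ∑ a, playInd o.1 a * rewardVal (o.2.2 a) = rewardVal (o.2.2 o.1) := by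
    intro o
    simp [playInd]
  have h1 : ∀ a l : Arm, ∑ ρ : Arm → Bool, outcomeWeight r p (a, l, ρ) * rewardVal (ρ a) =
      (if l ∈ leaders p then 1 / ((leaders p).card : ℝ) else 0) * (p a * r a) := by
    intro a l
    have := sum_bernoulli r a rewardVal
    rw [show rewardVal true = 1 from rfl, show rewardVal false = 0 from rfl] at this
    rw [Finset.sum_congr rfl fun ρ _ => show outcomeWeight r p (a, l, ρ) * rewardVal (ρ a) =
      (if l ∈ leaders p then 1 / ((leaders p).card : ℝ) else 0) * p a *
      ((∏ b, (if ρ b then r b else 1 - r b)) * rewardVal (ρ a)) by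
        rw [outcomeWeight]; ring, ← Finset.mul_sum, this]
    ring
  simp only [h0]
  rw [Fintype.sum_prod_type]
  simp only [Fintype.sum_prod_type, h1, ← Finset.sum_mul, Finset.sum_ite_mem, Finset.univ_inter,
    Finset.sum_const, nsmul_eq_mul]
  rw [mul_one_div_cancel hc]
  simp

lemma regret_eq (h : IsRun P r (logLogRate β) p₀ A L R)
    (hStar : ∀ a, a ≠ aStar → r a < r aStar) (hβ : 0 < β) (hβ1 : β ≤ 1)
    (hp₀ : IsInterior p₀) (T : ℕ) :
    regret P r A R T = ∑ t ∈ Finset.range T,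
      ∫ ω, ∑ a, prob (logLogRate β) p₀ A L R t ω a * (r aStar - r a) ∂P := by
  have h1 : ∀ t, ∫ ω, ∑ a, prob (logLogRate β) p₀ A L R t ω a * (r aStar - r a) ∂P =
      r aStar - ∫ ω, ∑ a, playInd (A t ω) a * rewardVal (R t ω a) ∂P := by
    intro t
    rw [h.integral_reward hβ hβ1 hp₀ t]
    have hi := h.integrable_comp t fun q => ∑ a, q a * r a
    rw [show r aStar = ∫ _, r aStar ∂P by simp, ← integral_sub (integrable_const _) hi]
    refine integral_congr_ae ?_
    filter_upwards [h.ae_isInterior hβ hβ1 hp₀ t] with ω hω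
    simp only [mul_sub, Finset.sum_sub_distrib, ← Finset.sum_mul, hω.2, one_mul]
    simp
  rw [regret, bestMean_eq hStar, integral_finsetSum _ fun t _ =>
    h.integrable_pair t fun _ o => ∑ a, playInd o.1 a * rewardVal (o.2.2 a),
    Finset.sum_congr rfl fun t _ => h1 t, Finset.sum_sub_distrib, Finset.sum_const,
    Finset.card_range, nsmul_eq_mul, mul_comm]

lemma regret_le_natCast (h : IsRun P r (logLogRate β) p₀ A L R)
    (hr : ∀ a, r a ∈ Set.Icc (0 : ℝ) 1) (hStar : ∀ a, a ≠ aStar → r a < r aStar) (hβ : 0 < β)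
    (hβ1 : β ≤ 1) (hp₀ : IsInterior p₀) (T : ℕ) : regret P r A R T ≤ T := by
  rw [h.regret_eq hStar hβ hβ1 hp₀]
  calc _ ≤ ∑ t ∈ Finset.range T, (1 : ℝ) := Finset.sum_le_sum fun t _ => ?_
    _ = T := by simp
  have h1 : (1 : ℝ) = ∫ _, 1 ∂P := by simp
  rw [h1]
  refine integral_mono_ae (h.integrable_comp t fun q => ∑ a, q a * (r aStar - r a))
    (integrable_const _) ?_
  filter_upwards [h.ae_isInterior hβ hβ1 hp₀ t] with ω hω
  rw [← hω.2]
  refine Finset.sum_le_sum fun a _ => ?_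
  nlinarith [hω.1 a, (hr aStar).2, (hr a).1]

/-- The regret is bounded by the truncated potential at `0`. -/
lemma regret_le_potential [Nonempty Arm] (h : IsRun P r (logLogRate β) p₀ A L R)
    (hr : ∀ a, r a ∈ Set.Icc (0 : ℝ) 1) (hStar : ∀ a, a ≠ aStar → r a < r aStar) (hβ : 0 < β)
    (hβ1 : β ≤ 1) (hp₀ : IsInterior p₀) {δ : ℝ} (hδ : 0 < δ) (hδ1 : δ ≤ 1) (T : ℕ) :
    regret P r A R T ≤ ((Fintype.card Arm : ℝ) - 1) * (truncPotential β δ 0 + T * (δ / 3)) +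
      ∑ t ∈ Finset.range T,
        P.real {ω | prob (logLogRate β) p₀ A L R t ω aStar ≤ 1 / 2} := by
  set X := prob (logLogRate β) p₀ A L R with hX
  set F : (Arm → ℝ) → ℝ := fun q => ∑ a ∈ Finset.univ.erase aStar, truncPotential β δ (q a)
  have hcard : ((Finset.univ.erase aStar).card : ℝ) = (Fintype.card Arm : ℝ) - 1 := by
    rw [Finset.card_erase_of_mem (Finset.mem_univ _), Finset.card_univ,
      Nat.cast_sub (Fintype.card_pos_iff.2 ⟨aStar⟩), Nat.cast_one]
  have hF0 : ∀ t, 0 ≤ ∫ ω, F (X t ω) ∂P := fun t => by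
    refine integral_nonneg_of_ae ?_
    filter_upwards [h.ae_isInterior hβ hβ1 hp₀ t] with ω hω
    exact Finset.sum_nonneg fun a _ => truncPotential_nonneg hβ hδ hδ1 (hω.le_one a)
  have hF1 : ∀ t, ∫ ω, F (X t ω) ∂P ≤ ((Fintype.card Arm : ℝ) - 1) * truncPotential β δ 0 := by
    intro t
    rw [show ((Fintype.card Arm : ℝ) - 1) * truncPotential β δ 0 =
      ∫ _, ((Fintype.card Arm : ℝ) - 1) * truncPotential β δ 0 ∂P by simp]
    refine integral_mono_ae (h.integrable_comp t F) (integrable_const _) ?_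
    filter_upwards [h.ae_isInterior hβ hβ1 hp₀ t] with ω hω
    rw [← hcard, ← nsmul_eq_mul, ← Finset.sum_const]
    exact Finset.sum_le_sum fun a _ =>
      truncPotential_le_zero hβ hδ hδ1 (hω.1 a).le (hω.le_one a)
  have hstep : ∀ t, ∫ ω, ∑ a, X t ω a * (r aStar - r a) ∂P ≤
      ∫ ω, F (X (t + 1) ω) ∂P - ∫ ω, F (X t ω) ∂P +
        P.real {ω | X t ω aStar ≤ 1 / 2} + ((Fintype.card Arm : ℝ) - 1) * (δ / 3) := by
    intro t
    have hXa : Measurable fun ω => X t ω aStar :=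
      (measurable_pi_apply aStar).comp (h.measurable_prob t)
    have hm : MeasurableSet {ω | X t ω aStar ≤ 1 / 2} := measurableSet_le hXa measurable_const
    have hq : P.real {ω | X t ω aStar ≤ 1 / 2} =
        ∫ ω, (if X t ω aStar ≤ 1 / 2 then 1 else 0) ∂P := by
      rw [← integral_indicator_one hm]
      refine integral_congr_ae (Eventually.of_forall fun ω => ?_)
      simp [Set.indicator]
    have hi1 := h.integrable_comp t F
    have hi2 := h.integrable_comp t fun p => stepMean r (logLogRate β) p F
    have hi3 := h.integrable_comp t fun p => if p aStar ≤ 1 / 2 then 1 else 0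
    have hi4 := h.integrable_comp t fun q => ∑ a, q a * (r aStar - r a)
    have hi5 : Integrable (fun _ : Ω => ((Fintype.card Arm : ℝ) - 1) * (δ / 3)) P :=
      integrable_const _
    have hmono := integral_mono_ae hi4 (((hi2.sub hi1).add hi3).add hi5) (by
      filter_upwards [h.ae_isInterior hβ hβ1 hp₀ t] with ω hω
      have := le_stepMean hω fun l hl => regret_le_potential_drift hr hStar hβ hβ1 hδ hδ1 hω hl
      simp only [Pi.add_apply, Pi.sub_apply]
      linarith)
    rw [integral_add' ((hi2.sub hi1).add hi3) hi5, integral_add' (hi2.sub hi1) hi3,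
      integral_sub' hi2 hi1, ← h.integral_prob_succ t F, ← hX, ← hq] at hmono
    simpa using hmono
  have hsum : ∀ T : ℕ, ∑ t ∈ Finset.range T, ∫ ω, ∑ a, X t ω a * (r aStar - r a) ∂P ≤
      ∫ ω, F (X T ω) ∂P - ∫ ω, F (X 0 ω) ∂P +
        ∑ t ∈ Finset.range T, P.real {ω | X t ω aStar ≤ 1 / 2} +
        T * (((Fintype.card Arm : ℝ) - 1) * (δ / 3)) := by
    intro T
    induction T with
    | zero => simp
    | succ T ih =>
      rw [Finset.sum_range_succ, Finset.sum_range_succ]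
      push_cast
      linarith [hstep T]
  rw [h.regret_eq hStar hβ hβ1 hp₀]
  linarith [hsum T, hF0 0, hF1 T]

theorem regret_le [Nontrivial Arm] (h : IsRun P r (logLogRate β) p₀ A L R)
    (hr : ∀ a, r a ∈ Set.Icc (0 : ℝ) 1) (hStar : ∀ a, a ≠ aStar → r a < r aStar) (hβ : 0 < β)
    (hβ1 : β ≤ 1) (hp₀ : IsInterior p₀) {T : ℕ} (hT : 1 ≤ T) :
    regret P r A R T ≤
      (Fintype.card Arm : ℝ) / (β * gap r aStar) *
          Real.log T * Real.log (Real.exp 1 + Real.log T)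
        + (∑' t, P.real {ω | prob (logLogRate β) p₀ A L R t ω aStar ≤ 1 / 2}) + 1 := by
  set Q := ∑' t, P.real {ω | prob (logLogRate β) p₀ A L R t ω aStar ≤ 1 / 2}
  have hQ : ∀ T, ∑ t ∈ Finset.range T,
      P.real {ω | prob (logLogRate β) p₀ A L R t ω aStar ≤ 1 / 2} ≤ Q := fun T =>
    (h.summable_measureReal_le_half hr hStar hβ hβ1 hp₀).sum_le_tsum _
      fun _ _ => measureReal_nonneg
  have hQ0 : 0 ≤ Q := by simpa using hQ 0
  have hg1 : gap r aStar ≤ 1 := by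
    obtain ⟨b, hb⟩ := exists_ne aStar
    linarith [gap_le hStar hb, (hr aStar).2, (hr b).1]
  -- Applied to the regret minus `Q`; since `Q ≥ 0`, the trivial bound by `T` persists.
  have key := le_of_potential_bound (N := Fintype.card Arm) (T := T) (x := regret P r A R T - Q)
    Fintype.one_lt_card hT hβ hβ1 (gap_pos hStar) hg1
    (by linarith [h.regret_le_natCast hr hStar hβ hβ1 hp₀ T]) (fun hT3 => ?_)
  · linarith
  have hT0 : (3 : ℝ) ≤ T := by exact_mod_cast hT3
  have he : Real.exp 1 / T ≤ 1 := by
    rw [div_le_one (by linarith)]; linarith [Real.exp_one_lt_d9]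
  -- The level is `δ = e / T`, at most `1` as `T ≥ 3`. The truncation then costs `e / 3` per arm
  -- over the whole horizon, and `-log δ = log T - 1` leaves exactly the unit interval needed to
  -- absorb the frozen part.
  have h1 := h.regret_le_potential hr hStar hβ hβ1 hp₀
    (div_pos (Real.exp_pos 1) (by linarith : (0 : ℝ) < T)) he T
  have hlog : -Real.log (Real.exp 1 / T) = Real.log T - 1 := by
    rw [Real.log_div (Real.exp_ne_zero 1) (by linarith), Real.log_exp]; ring
  have hL : 0 ≤ Real.log T - 1 := by
    rw [← hlog]
    exact neg_nonneg.2 (Real.log_nonpos (by positivity) he)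
  have h2 := log_add_logPrimitive_le hL
  rw [truncPotential_zero hβ (div_pos (Real.exp_pos 1) (by linarith)) he, show Real.exp 1 - Real.log (Real.exp 1 / T) =
    Real.exp 1 + (Real.log T - 1) by rw [← hlog]; ring, hlog] at h1
  have hN : 0 ≤ (Fintype.card Arm : ℝ) - 1 := by
    have : (1 : ℝ) ≤ Fintype.card Arm := by exact_mod_cast Fintype.card_pos (α := Arm)
    linarith
  have h3 : (Real.log (Real.exp 1 + (Real.log T - 1)) + logPrimitive (Real.log T - 1)) / β +
      T * (Real.exp 1 / T / 3) ≤ logPrimitive (Real.log T) / β + Real.exp 1 / 3 := by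
    have e : T * (Real.exp 1 / T / 3) = Real.exp 1 / 3 := by field_simp
    rw [e]
    rw [sub_add_cancel] at h2
    gcongr
  have h4 := mul_le_mul_of_nonneg_left h3 hN
  linarith [hQ T]

end IsRun

end Run

end SAMBA

theorem theorem3 {Arm Ω : Type*} [Fintype Arm] [DecidableEq Arm] [Nontrivial Arm]
    [MeasurableSpace Arm] [MeasurableSingletonClass Arm]
    [MeasurableSpace Ω] (P : Measure Ω) [IsProbabilityMeasure P]
    (r : Arm → ℝ) (hr : ∀ a, r a ∈ Set.Icc (0 : ℝ) 1)
    (aStar : Arm) (hStar : ∀ a, a ≠ aStar → r a < r aStar)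
    (β : ℝ) (hβ : β ∈ Set.Ioc (0 : ℝ) 1)
    (p₀ : Arm → ℝ) (hp₀_pos : ∀ a, 0 < p₀ a) (hp₀_sum : ∑ a, p₀ a = 1)
    (A L : ℕ → Ω → Arm) (R : ℕ → Ω → Arm → Bool)
    (hrun : SAMBA.IsRun P r (SAMBA.logLogRate β) p₀ A L R) :
    SAMBA.IsMarkovChain P (SAMBA.prob (SAMBA.logLogRate β) p₀ A L R) ∧
    (∀ᵐ ω ∂P, Tendsto (fun t => SAMBA.prob (SAMBA.logLogRate β) p₀ A L R t ω aStar)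
      atTop (𝓝 1)) ∧
    Summable (fun t => P.real {ω | SAMBA.prob (SAMBA.logLogRate β) p₀ A L R t ω aStar ≤ 1 / 2}) ∧
    ∀ T : ℕ, 1 ≤ T →
      SAMBA.regret P r A R T ≤
        (Fintype.card Arm : ℝ) / (β * SAMBA.gap r aStar) *
            Real.log T * Real.log (Real.exp 1 + Real.log T)
          + (∑' t, P.real {ω | SAMBA.prob (SAMBA.logLogRate β) p₀ A L R t ω aStar ≤ 1 / 2})
          + 1 := by
  have hp₀ : SAMBA.IsInterior p₀ := ⟨hp₀_pos, hp₀_sum⟩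
  exact ⟨hrun.isMarkovChain hr hβ.1 hβ.2 hp₀, hrun.ae_tendsto_one hr hStar hβ.1 hβ.2 hp₀,
    hrun.summable_measureReal_le_half hr hStar hβ.1 hβ.2 hp₀,
    fun T hT => hrun.regret_le hr hStar hβ.1 hβ.2 hp₀ hT⟩
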